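/- Let $K$ be a field. All functors are covariant functors on the category of commutative $K$-algebras; a functor of sets (monoids, …) takes values in sets (monoids, …). Let $\mathcal K$ be the functor of rings $\mathcal K(S)=S$. A functor of $\mathcal K$-modules is a functor of sets $\mathbb M$ with an $S$-module structure on each $\mathbb M(S)$ whose operations $\mathbb M\times\mathbb M\to\mathbb M$, $\mathcal K\times\mathbb M\to\mathbb M$ are morphisms of functors; functors of (associative unital) $\mathcal K$-algebras are defined likewise, and $(\mathbb M\otimes\mathbb N)(S)=\mathbb M(S)\otimes_S\mathbb N(S)$. The dual is $\mathbb M^*(S)=\mathrm{Hom}_{\mathcal S}(\mathbb M_{|S},\mathcal S)$, where $_{|S}$ is restriction to commutative $S$-algebras; $\mathbb M$ is reflexive if the canonical morphism $\mathbb M\to\mathbb M^{**}$ is an isomorphism; $\mathbb M\tilde\otimes\mathbb N:=(\mathbb M^*\otimes\mathbb N^*)^*$. A $K$-algebra $A$ defines the quasi-coherent algebra $\mathcal A(S)=A\otimes_KS$. A functor of algebras is pro-quasicoherent if it is the inverse limit of its quasi-coherent algebra quotients (epimorphisms of functors of algebras onto some $\mathcal A$). If $\mathbb B$ is reflexive and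 pro-quasicoherent with quasi-coherent algebra quotients $\mathcal B_i$, then $\mathbb B\tilde\otimes\mathbb B=\varprojlim_{i,j}\mathcal B_i\otimes\mathcal B_j$ carries the algebra structure of this limit. A functor of commutative bialgebras is a reflexive pro-quasicoherent functor of commutative $\mathcal K$-algebras $\mathbb B$ together with a structure of functor of $\mathcal K$-algebras on $\mathbb B^*$ such that the dual morphisms $\mathbb B\to\mathbb B\tilde\otimes\mathbb B$ and $\mathbb B\to\mathcal K$ of the multiplication $\mathbb B^*\otimes\mathbb B^*\to\mathbb B^*$ and of the unit $\mathcal K\to\mathbb B^*$ are morphisms of functors of algebras. A morphism of functors of bialgebras is a morphism of $\mathcal K$-modules $f\colon\mathbb B\to\mathbb B'$ such that $f$ and $f^*$ are morphisms of functors of algebras. For a functor of sets $\mathbb X$, let $\mathbb A_{\mathbb X}$ be its functor of functions, $\mathbb A_{\mathbb X}(S)=\mathrm{Hom}(\mathbb X_{|S},\mathcal S)$, with pointwise algebra structure. For a functor of commutative algebras $\mathbb A$, let $(\mathrm{Spec}\,\mathbb A)(S)\subseteq\mathbb A^*(S)$ be the set of morphisms of functors of $\mathcal S$-algebras $\mathbb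 A_{|S}\to\mathcal S$. The functor $\mathbb X$ is affine if $\mathbb A_{\mathbb X}$ is set-valued and reflexive and the canonical morphism $\mathbb X\to\mathrm{Spec}\,\mathbb A_{\mathbb X}$ is an isomorphism. An affine functor of monoids is a functor of monoids whose underlying functor of sets is affine. Theorem. The category of affine functors of monoids over $K$ (with the morphisms of functors of monoids) is anti-equivalent to the category of functors of commutative bialgebras over $K$, via $\mathbb G\mapsto\mathbb A_{\mathbb G}$. Here a morphism $h\colon\mathbb G\to\mathbb G'$ goes to $\mathbb A_{\mathbb G'}\to\mathbb A_{\mathbb G}$, $a\mapsto a\circ h$, the algebra structure on $\mathbb A_{\mathbb G}$ is the pointwise one, and that on $\mathbb A_{\mathbb G}^*$ makes the canonical map $\mathbb G\to\mathbb A_{\mathbb G}^*$ a morphism of functors of monoids. -/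

import Mathlib

open CategoryTheory TensorProduct

universe u v w

/-- A functor of `𝓡`-modules: a functor `M` on the category of commutative `R`-algebras such that
`M(S)` is an `S`-module and addition and scalar multiplication are morphisms of functors.
The values lie in `Type v`; "set-valued" means `v = u`. -/
structure ModFun (R : Type u) [CommRing R] where
  obj : CommAlgCat.{u} R → Type v
  [addCommGroup : ∀ S : CommAlgCat.{u} R, AddCommGroup (obj S)]
  [module : ∀ S : CommAlgCat.{u} R, Module S (obj S)]
  map : ∀ {S T : CommAlgCat.{u} R} (f : S ⟶ T), obj S →ₛₗ[(f.hom : S →+* T)] obj T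
  map_id : ∀ (S : CommAlgCat.{u} R) (m : obj S), map (𝟙 S) m = m
  map_comp : ∀ {S T U : CommAlgCat.{u} R} (f : S ⟶ T) (g : T ⟶ U) (m : obj S),
    map (f ≫ g) m = map g (map f m)

attribute [instance] ModFun.addCommGroup ModFun.module

namespace ModFun

variable {R : Type u} [CommRing R]

/-- Morphisms of functors of `𝓡`-modules. -/
@[ext]
structure Hom (M : ModFun.{u, v} R) (N : ModFun.{u, w} R) where
  app : ∀ S : CommAlgCat.{u} R, M.obj S →ₗ[S] N.obj S
  naturality : ∀ {S T : CommAlgCat.{u} R} (f : S ⟶ T) (m : M.obj S),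
    app T (M.map f m) = N.map f (app S m)

/-- The identity morphism. -/
def Hom.id (M : ModFun.{u, v} R) : Hom M M where
  app _ := LinearMap.id
  naturality _ _ := rfl

universe v₁ v₂ v₃ v₄

/-- Composition, in diagrammatic order: first `f`, then `g`. -/
def Hom.comp {M : ModFun.{u, v₁} R} {N : ModFun.{u, v₂} R} {P : ModFun.{u, v₃} R}
    (f : Hom M N) (g : Hom N P) : Hom M P where
  app S := (g.app S).comp (f.app S)
  naturality h m := by simp [f.naturality, g.naturality]

/-- A morphism of functors of modules is an epimorphism of functors if it is surjective on all
values. -/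
def Hom.Surjective {M : ModFun.{u, v₁} R} {N : ModFun.{u, v₂} R} (f : Hom M N) : Prop :=
  ∀ S, Function.Surjective (f.app S)

/-- A morphism of functors of modules is an isomorphism if it is bijective on all values. -/
def Hom.Bijective {M : ModFun.{u, v₁} R} {N : ModFun.{u, v₂} R} (f : Hom M N) : Prop :=
  ∀ S, Function.Bijective (f.app S)

/-- The functor `𝓡`, `𝓡(S) = S`. -/
abbrev scalars (R : Type u) [CommRing R] : ModFun.{u, u} R where
  obj S := S
  map f :=
    { toFun := f.hom
      map_add' := map_add _
      map_smul' := fun a b => map_mul f.hom a b }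
  map_id _ _ := rfl
  map_comp _ _ _ := rfl

/-- The tensor product, `(M ⊗ N)(S) = M(S) ⊗_S N(S)`. -/
abbrev tensor (M : ModFun.{u, v₁} R) (N : ModFun.{u, v₂} R) : ModFun.{u, max v₁ v₂} R where
  obj S := M.obj S ⊗[S] N.obj S
  map f := TensorProduct.map (M.map f) (N.map f)
  map_id S x := by
    induction x with
    | zero => rw [map_zero]
    | tmul m n => rw [TensorProduct.map_tmul, M.map_id, N.map_id]
    | add x y hx hy => rw [map_add, hx, hy]
  map_comp f g x := by
    induction x with
    | zero => simp
    | tmul m n => simp [M.map_comp, N.map_comp]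
    | add x y hx hy => rw [map_add, hx, hy, map_add, map_add]

/-- The tensor product of two morphisms. -/
def tensorMap {M : ModFun.{u, v₁} R} {N : ModFun.{u, v₂} R} {M' : ModFun.{u, v₃} R}
    {N' : ModFun.{u, v₄} R} (f : Hom M M') (g : Hom N N') :
    Hom (tensor M N) (tensor M' N') where
  app S := TensorProduct.map (f.app S) (g.app S)
  naturality {S T} h x := by
    change TensorProduct.map (f.app T) (g.app T) (TensorProduct.map (M.map h) (N.map h) x) =
      TensorProduct.map (M'.map h) (N'.map h) (TensorProduct.map (f.app S) (g.app S) x)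
    change M.obj S ⊗[S] N.obj S at x
    induction x with
    | zero => simp
    | tmul m n => simp [f.naturality, g.naturality]
    | add x y hx hy => simp only [map_add, hx, hy]

/-- An element of `M*(S) = Hom_𝓢(M|_S, 𝓢)`. A commutative `S`-algebra is a commutative
`R`-algebra `T` with a morphism `S ⟶ T` of `R`-algebras; the element is a family of `T`-linear
maps `M(T) → T`, one for each commutative `S`-algebra `T`, compatible with the morphisms of
`S`-algebras. -/
@[ext]
structure DualElt (M : ModFun.{u, v} R) (S : CommAlgCat.{u} R) where
  app : ∀ (T : CommAlgCat.{u} R), (S ⟶ T) → (M.obj T →ₗ[T] T)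
  naturality : ∀ {T U : CommAlgCat.{u} R} (f : S ⟶ T) (g : T ⟶ U) (m : M.obj T),
    app U (f ≫ g) (M.map g m) = g.hom (app T f m)

namespace DualElt

variable {M : ModFun.{u, v} R} {S : CommAlgCat.{u} R}

instance : Zero (DualElt M S) := ⟨⟨fun _ _ => 0, by simp⟩⟩

instance : Add (DualElt M S) :=
  ⟨fun a b => ⟨fun T f => a.app T f + b.app T f, by simp [a.naturality, b.naturality]⟩⟩

instance : Neg (DualElt M S) :=
  ⟨fun a => ⟨fun T f => -a.app T f, by simp [a.naturality]⟩⟩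

/-- An element `s` of `S` acts on the values in the `S`-algebra `f : S ⟶ T` through `f s`. -/
instance : SMul S (DualElt M S) :=
  ⟨fun s a => ⟨fun T f => f.hom s • a.app T f, by simp [a.naturality]⟩⟩

@[simp] lemma zero_app (T : CommAlgCat.{u} R) (f : S ⟶ T) : (0 : DualElt M S).app T f = 0 := rfl
@[simp] lemma add_app (a b : DualElt M S) (T : CommAlgCat.{u} R) (f : S ⟶ T) :
    (a + b).app T f = a.app T f + b.app T f := rfl
@[simp] lemma neg_app (a : DualElt M S) (T : CommAlgCat.{u} R) (f : S ⟶ T) :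
    (-a).app T f = -a.app T f := rfl
@[simp] lemma smul_app (s : S) (a : DualElt M S) (T : CommAlgCat.{u} R) (f : S ⟶ T) :
    (s • a).app T f = f.hom s • a.app T f := rfl

instance : AddCommGroup (DualElt M S) where
  add_assoc a b c := by ext; simp [add_assoc]
  zero_add a := by ext; simp
  add_zero a := by ext; simp
  add_comm a b := by ext; simp [add_comm]
  neg_add_cancel a := by ext; simp
  nsmul := nsmulRec
  zsmul := zsmulRec

instance : Module S (DualElt M S) where
  one_smul a := by ext; simp
  mul_smul s t a := by ext; simp [mul_assoc]
  smul_zero s := by ext; simp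
  smul_add s a b := by ext; simp
  add_smul s t a := by ext; simp [add_mul]
  zero_smul a := by ext; simp

end DualElt

/-- The dual functor `M* = ℍom_𝓡(M, 𝓡)`. -/
abbrev dual (M : ModFun.{u, v} R) : ModFun.{u, max (u + 1) v} R where
  obj S := DualElt M S
  map h :=
    { toFun := fun a => ⟨fun T f => a.app T (h ≫ f), fun f g m => by
        rw [← Category.assoc]; exact a.naturality _ _ _⟩
      map_add' := fun _ _ => rfl
      map_smul' := fun _ _ => by ext; simp }
  map_id S a := by
    apply DualElt.ext
    funext T f
    exact congrArg (a.app T) (Category.id_comp f)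
  map_comp f g a := by
    apply DualElt.ext
    funext T h
    exact congrArg (a.app T) (Category.assoc f g h)

/-- The dual morphism `f* : N* → M*` of `f : M → N`. -/
def dualMap {M : ModFun.{u, v₁} R} {N : ModFun.{u, v₂} R} (f : Hom M N) :
    Hom (dual N) (dual M) where
  app S :=
    { toFun := fun (a : DualElt N S) => (⟨fun T h => (a.app T h).comp (f.app T), fun g h m => by
        simp [f.naturality, a.naturality]⟩ : DualElt M S)
      map_add' := fun _ _ => rfl
      map_smul' := fun _ _ => rfl }
  naturality _ _ := rfl

/-- The canonical morphism `M → M**`, `m ↦ (w ↦ w(m))`. -/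
def toBidual (M : ModFun.{u, v} R) : Hom M (dual (dual M)) where
  app S :=
    { toFun := fun m => (⟨fun T f =>
        { toFun := fun a : DualElt M T => a.app T (𝟙 T) (M.map f m)
          map_add' := fun _ _ => rfl
          map_smul' := fun _ _ => rfl }, fun {T U} f g a => by
            change DualElt.app a U (g ≫ 𝟙 U) (M.map (f ≫ g) m) =
              g.hom (DualElt.app a T (𝟙 T) (M.map f m))
            rw [M.map_comp, ← DualElt.naturality a, Category.comp_id,
              Category.id_comp]⟩ : DualElt (dual M) S)
      map_add' := fun m n => by
        ext T f a
        change a.app T (𝟙 T) (M.map f (m + n)) =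
          a.app T (𝟙 T) (M.map f m) + a.app T (𝟙 T) (M.map f n)
        rw [map_add, map_add]
      map_smul' := fun s m => by
        ext T f a
        change a.app T (𝟙 T) (M.map f (s • m)) = f.hom s • a.app T (𝟙 T) (M.map f m)
        rw [LinearMap.map_smulₛₗ, map_smul]
        rfl }
  naturality f m := by
    ext T g a
    change DualElt.app a T (𝟙 T) (M.map g (M.map f m)) =
      DualElt.app a T (𝟙 T) (M.map (f ≫ g) m)
    rw [M.map_comp]

/-- `M` is reflexive if the canonical morphism `M → M**` is an isomorphism. -/
def IsReflexive (M : ModFun.{u, v} R) : Prop := (toBidual M).Bijective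

/-- `M ⊗̃ N = (M* ⊗ N*)*`. -/
abbrev tildeTensor (M : ModFun.{u, v₁} R) (N : ModFun.{u, v₂} R) :
    ModFun.{u, max (u + 1) v₁ v₂} R :=
  dual (tensor (dual M) (dual N))

/-- The morphism `M ⊗̃ N → M' ⊗̃ N'` induced by `M → M'` and `N → N'`. -/
def tildeMap {M : ModFun.{u, v₁} R} {N : ModFun.{u, v₂} R} {M' : ModFun.{u, v₃} R}
    {N' : ModFun.{u, v₄} R} (f : Hom M M') (g : Hom N N') :
    Hom (tildeTensor M N) (tildeTensor M' N') :=
  dualMap (tensorMap (dualMap f) (dualMap g))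

/-- The natural pairing of `(M ⊗ N)(S)` with `(M* ⊗ N*)(S)`, `(m ⊗ n, a ⊗ b) ↦ a(m) b(n)`. -/
noncomputable def pairing (M : ModFun.{u, v₁} R) (N : ModFun.{u, v₂} R) (S : CommAlgCat.{u} R) :
    (tensor M N).obj S →ₗ[S] (tensor (dual M) (dual N)).obj S →ₗ[S] S :=
  TensorProduct.lift <| LinearMap.mk₂ S
    (fun m n => TensorProduct.lift <| LinearMap.mk₂ S
      (fun (a : DualElt M S) (b : DualElt N S) => a.app S (𝟙 S) m * b.app S (𝟙 S) n)
      (fun a a' b => by simp [add_mul]) (fun s a b => by simp [mul_assoc])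
      (fun a b b' => by simp [mul_add]) (fun s a b => by simp [mul_left_comm]))
    (fun m m' n => TensorProduct.ext' fun a b => by simp [add_mul])
    (fun s m n => TensorProduct.ext' fun a b => by simp [mul_assoc])
    (fun m n n' => TensorProduct.ext' fun a b => by simp [mul_add])
    (fun s m n => TensorProduct.ext' fun a b => by simp [mul_left_comm])

lemma pairing_tmul (M : ModFun.{u, v₁} R) (N : ModFun.{u, v₂} R) (S : CommAlgCat.{u} R)
    (m : M.obj S) (n : N.obj S) (a : DualElt M S) (b : DualElt N S) :
    pairing M N S (m ⊗ₜ[S] n) ((a : (dual M).obj S) ⊗ₜ[S] (b : (dual N).obj S)) =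
      a.app S (𝟙 S) m * b.app S (𝟙 S) n := rfl

lemma pairing_map (M : ModFun.{u, v₁} R) (N : ModFun.{u, v₂} R) {S T : CommAlgCat.{u} R}
    (f : S ⟶ T) (x : (tensor M N).obj S) (y : (tensor (dual M) (dual N)).obj S) :
    pairing M N T ((tensor M N).map f x) ((tensor (dual M) (dual N)).map f y) =
      f.hom (pairing M N S x y) := by
  change M.obj S ⊗[S] N.obj S at x
  change DualElt M S ⊗[S] DualElt N S at y
  induction x with
  | zero => rw [map_zero, map_zero]; simp
  | add x x' hx hx' =>
    rw [map_add, map_add, LinearMap.add_apply, hx, hx', map_add, LinearMap.add_apply, map_add]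
  | tmul m n =>
    induction y with
    | zero => rw [map_zero, map_zero, map_zero, map_zero]
    | add y y' hy hy' => rw [map_add, map_add, hy, hy', map_add, map_add]
    | tmul a b =>
      change DualElt.app a T (f ≫ 𝟙 T) (M.map f m) * DualElt.app b T (f ≫ 𝟙 T) (N.map f n) =
        f.hom (DualElt.app a S (𝟙 S) m * DualElt.app b S (𝟙 S) n)
      rw [map_mul, ← DualElt.naturality a, ← DualElt.naturality b, Category.comp_id,
        Category.id_comp]

/-- The canonical morphism `M ⊗ N → M ⊗̃ N`. -/
noncomputable def toTilde (M : ModFun.{u, v₁} R) (N : ModFun.{u, v₂} R) :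
    Hom (tensor M N) (tildeTensor M N) where
  app S :=
    { toFun := fun x => (⟨fun T f => pairing M N T ((tensor M N).map f x), fun f g y => by
        rw [(tensor M N).map_comp, pairing_map]⟩ : DualElt (tensor (dual M) (dual N)) S)
      map_add' := fun x y => by
        apply DualElt.ext
        funext T f
        change pairing M N T ((tensor M N).map f (x + y)) =
          pairing M N T ((tensor M N).map f x) + pairing M N T ((tensor M N).map f y)
        rw [map_add, map_add]
      map_smul' := fun s x => by
        apply DualElt.ext
        funext T f
        change pairing M N T ((tensor M N).map f (s • x)) =
          f.hom s • pairing M N T ((tensor M N).map f x)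
        rw [LinearMap.map_smulₛₗ, map_smul]
        rfl }
  naturality f x := by
    apply DualElt.ext
    funext T g
    exact congrArg (pairing M N T) ((tensor M N).map_comp f g x).symm

end ModFun

open ModFun

/-- The structure of a functor of (associative unital) `𝓡`-algebras on a functor of
`𝓡`-modules. -/
@[ext]
structure AlgStr {R : Type u} [CommRing R] (M : ModFun.{u, v} R) where
  mul : ∀ S : CommAlgCat.{u} R, M.obj S →ₗ[S] M.obj S →ₗ[S] M.obj S
  one : ∀ S : CommAlgCat.{u} R, M.obj S
  mul_assoc : ∀ S a b c, mul S (mul S a b) c = mul S a (mul S b c)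
  one_mul : ∀ S a, mul S (one S) a = a
  mul_one : ∀ S a, mul S a (one S) = a
  map_mul : ∀ {S T : CommAlgCat.{u} R} (f : S ⟶ T) (a b : M.obj S),
    M.map f (mul S a b) = mul T (M.map f a) (M.map f b)
  map_one : ∀ {S T : CommAlgCat.{u} R} (f : S ⟶ T), M.map f (one S) = one T

section Algebras

variable {R : Type u} [CommRing R]

universe v₁ v₂ v₃ v₄

/-- The morphism of functors of modules `f` is a morphism of functors of `𝓡`-algebras. -/
structure IsAlgHom {M : ModFun.{u, v₁} R} {N : ModFun.{u, v₂} R} (A : AlgStr M) (B : AlgStr N)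
    (f : Hom M N) : Prop where
  map_mul : ∀ S a b, f.app S (A.mul S a b) = B.mul S (f.app S a) (f.app S b)
  map_one : ∀ S, f.app S (A.one S) = B.one S

/-- Commutativity of a functor of algebras. -/
def AlgStr.IsComm {M : ModFun.{u, v} R} (A : AlgStr M) : Prop :=
  ∀ S a b, A.mul S a b = A.mul S b a

/-- The functor of algebras `𝓡`. -/
def scalarsAlg (R : Type u) [CommRing R] : AlgStr (scalars R) where
  mul S := LinearMap.mul S S
  one S := (1 : S)
  mul_assoc S a b c := _root_.mul_assoc (G := S) a b c
  one_mul S a := _root_.one_mul (M := S) a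
  mul_one S a := _root_.mul_one (M := S) a
  map_mul f a b := _root_.map_mul f.hom a b
  map_one f := _root_.map_one f.hom

/-- The multiplication as a morphism `M ⊗ M → M`. -/
def AlgStr.mulHom {M : ModFun.{u, v} R} (A : AlgStr M) : Hom (tensor M M) M where
  app S := TensorProduct.lift (A.mul S)
  naturality {S T} f x := by
    change M.obj S ⊗[S] M.obj S at x
    induction x with
    | zero => rw [map_zero, map_zero, map_zero, map_zero]
    | add x y hx hy => rw [map_add, map_add, hx, hy, map_add, map_add]
    | tmul a b => exact (A.map_mul f a b).symm

/-- The unit as a morphism `𝓡 → M`. -/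
def AlgStr.unitHom {M : ModFun.{u, v} R} (A : AlgStr M) : Hom (scalars R) M where
  app S := LinearMap.toSpanSingleton S (M.obj S) (A.one S)
  naturality {S T} f s := by
    change f.hom s • A.one T = M.map f ((s : S) • A.one S)
    rw [LinearMap.map_smulₛₗ, A.map_one]
    rfl

/-- The tensor product of two functors of algebras,
`(a ⊗ b)(a' ⊗ b') = aa' ⊗ bb'`. -/
def AlgStr.tensor {M : ModFun.{u, v₁} R} {N : ModFun.{u, v₂} R} (A : AlgStr M) (B : AlgStr N) :
    AlgStr (ModFun.tensor M N) where
  mul S := TensorProduct.map₂ (A.mul S) (B.mul S)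
  one S := A.one S ⊗ₜ[S] B.one S
  mul_assoc S x y z := by
    change M.obj S ⊗[S] N.obj S at x y z
    induction x with
    | zero => simp
    | add x x' hx hx' => simp only [map_add, LinearMap.add_apply, hx, hx']
    | tmul m n =>
      induction y with
      | zero => simp
      | add y y' hy hy' => simp only [map_add, LinearMap.add_apply, hy, hy']
      | tmul m' n' =>
        induction z with
        | zero => simp
        | add z z' hz hz' => simp only [map_add, hz, hz']
        | tmul m'' n'' => simp [A.mul_assoc, B.mul_assoc]
  one_mul S x := by
    change M.obj S ⊗[S] N.obj S at x
    induction x with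
    | zero => simp
    | add x y hx hy => rw [map_add, hx, hy]
    | tmul m n => simp [A.one_mul, B.one_mul]
  mul_one S x := by
    change M.obj S ⊗[S] N.obj S at x
    induction x with
    | zero => simp
    | add x y hx hy => rw [map_add, LinearMap.add_apply, hx, hy]
    | tmul m n => simp [A.mul_one, B.mul_one]
  map_mul {S T} f x y := by
    change M.obj S ⊗[S] N.obj S at x y
    change TensorProduct.map (M.map f) (N.map f) (TensorProduct.map₂ (A.mul S) (B.mul S) x y) =
      TensorProduct.map₂ (A.mul T) (B.mul T) (TensorProduct.map (M.map f) (N.map f) x)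
        (TensorProduct.map (M.map f) (N.map f) y)
    induction x with
    | zero => simp
    | add x x' hx hx' => simp only [map_add, LinearMap.add_apply, hx, hx']
    | tmul m n =>
      induction y with
      | zero => simp
      | add y y' hy hy' => simp only [map_add, hy, hy']
      | tmul m' n' => simp [A.map_mul, B.map_mul]
  map_one f := by
    change M.map f _ ⊗ₜ N.map f _ = _
    rw [A.map_one, B.map_one]

/-- The quasi-coherent module associated with an `R`-module `V`, `S ↦ S ⊗_R V`. -/
noncomputable abbrev quasiCoherent (R : Type u) [CommRing R] (V : Type u) [AddCommGroup V]
    [Module R V] : ModFun.{u, u} R where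
  obj S := S ⊗[R] V
  map {S T} f :=
    { toFun := LinearMap.rTensor V f.hom.toLinearMap
      map_add' := map_add _
      map_smul' := fun s x => by
        induction x with
        | zero => simp
        | add x y hx hy => rw [smul_add, map_add, hx, hy, map_add, smul_add]
        | tmul t v => simp [TensorProduct.smul_tmul'] }
  map_id S x := by
    change LinearMap.rTensor V LinearMap.id x = x
    simp
  map_comp f g x := LinearMap.rTensor_comp_apply V g.hom.toLinearMap f.hom.toLinearMap x

/-- The quasi-coherent algebra associated with a (not necessarily commutative) `R`-algebra. -/
noncomputable def quasiCoherentAlg (R : Type u) [CommRing R] (A : Type u) [Ring A] [Algebra R A] :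
    AlgStr (quasiCoherent R A) where
  mul S := LinearMap.mul S (S ⊗[R] A)
  one S := (1 : S ⊗[R] A)
  mul_assoc S a b c := _root_.mul_assoc (G := S ⊗[R] A) a b c
  one_mul S a := _root_.one_mul (M := S ⊗[R] A) a
  mul_one S a := _root_.mul_one (M := S ⊗[R] A) a
  map_mul f a b := _root_.map_mul (Algebra.TensorProduct.map f.hom (AlgHom.id R A)) a b
  map_one f := _root_.map_one (Algebra.TensorProduct.map f.hom (AlgHom.id R A))

/-- A quasi-coherent algebra quotient of a functor of algebras. -/
structure QCQuotient {M : ModFun.{u, v} R} (A : AlgStr M) where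
  alg : Type u
  [ring : Ring alg]
  [algebra : Algebra R alg]
  proj : Hom M (quasiCoherent R alg)
  isAlgHom : IsAlgHom A (quasiCoherentAlg R alg) proj
  surjective : proj.Surjective

attribute [instance] QCQuotient.ring QCQuotient.algebra

/-- A functor of algebras is pro-quasicoherent if it is the inverse limit of its quasi-coherent
algebra quotients: for every `S`, each family of elements of the values at `S` of the quotients that
is compatible with all the morphisms of quotients comes from exactly one element. -/
def AlgStr.IsProQuasicoherent {M : ModFun.{u, v} R} (A : AlgStr M) : Prop :=
  ∀ (S : CommAlgCat.{u} R) (x : ∀ Q : QCQuotient A, (quasiCoherent R Q.alg).obj S),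
    (∀ (Q Q' : QCQuotient A) (t : Hom (quasiCoherent R Q.alg) (quasiCoherent R Q'.alg)),
      IsAlgHom (quasiCoherentAlg R Q.alg) (quasiCoherentAlg R Q'.alg) t →
      Q.proj.comp t = Q'.proj → t.app S (x Q) = x Q') →
    ∃! a : M.obj S, ∀ Q : QCQuotient A, Q.proj.app S a = x Q

/-- The comultiplication `M → M** → (M* ⊗ M*)* = M ⊗̃ M` dual to the multiplication of an algebra
structure on `M*`. -/
def comulHom {M : ModFun.{u, v} R} (D : AlgStr (dual M)) : Hom M (tildeTensor M M) :=
  (toBidual M).comp (dualMap D.mulHom)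

/-- The identification `𝓡* → 𝓡`, `w ↦ w(1)`. -/
def evalOne (R : Type u) [CommRing R] : Hom (dual (scalars R)) (scalars R) where
  app S :=
    { toFun := fun a : DualElt (scalars R) S => a.app S (𝟙 S) (1 : S)
      map_add' := fun _ _ => rfl
      map_smul' := fun _ _ => rfl }
  naturality {S T} f a := by
    change DualElt.app a T (f ≫ 𝟙 T) (1 : T) = f.hom (DualElt.app a S (𝟙 S) (1 : S))
    rw [← DualElt.naturality a, Category.comp_id, Category.id_comp]
    exact congrArg _ (_root_.map_one f.hom).symm

/-- The counit `M → M** → 𝓡* = 𝓡` dual to the unit of an algebra structure on `M*`. -/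
def counitHom {M : ModFun.{u, v} R} (D : AlgStr (dual M)) : Hom M (scalars R) :=
  ((toBidual M).comp (dualMap D.unitHom)).comp (evalOne R)

/-- A morphism of functors of modules `f : N → M ⊗̃ M` is a morphism of functors of algebras.
For a reflexive pro-quasicoherent `M`, the algebra structure of `M ⊗̃ M` is that of the inverse
limit of the algebras `𝓐 ⊗ 𝓐'`, where `𝓐` and `𝓐'` run over the quasi-coherent algebra quotients
of `M`, and `𝓐 ⊗ 𝓐' = 𝓐 ⊗̃ 𝓐'` through the canonical morphism. So `f` is a morphism of
algebras if and only if each composite `N → M ⊗̃ M → 𝓐 ⊗̃ 𝓐' = 𝓐 ⊗ 𝓐'` is one. -/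
def IsAlgHomToTilde {N : ModFun.{u, v₁} R} {M : ModFun.{u, v₂} R} (B : AlgStr N) (A : AlgStr M)
    (f : Hom N (tildeTensor M M)) : Prop :=
  ∀ Q Q' : QCQuotient A,
    ∃ g : Hom N (ModFun.tensor (quasiCoherent R Q.alg) (quasiCoherent R Q'.alg)),
      IsAlgHom B ((quasiCoherentAlg R Q.alg).tensor (quasiCoherentAlg R Q'.alg)) g ∧
      g.comp (toTilde _ _) = f.comp (tildeMap Q.proj Q'.proj)

end Algebras

/-- A functor of commutative bialgebras: a (set-valued) reflexive functor of pro-quasicoherent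
commutative algebras `B`, with the structure of a functor of algebras on `B*`, such that the dual
morphisms `B → B ⊗̃ B` and `B → 𝓡` of the multiplication and of the unit of `B*` are morphisms of
functors of algebras. -/
structure CommBialgFun (R : Type u) [CommRing R] where
  toModFun : ModFun.{u, u} R
  alg : AlgStr toModFun
  comm : alg.IsComm
  reflexive : toModFun.IsReflexive
  proQuasicoherent : alg.IsProQuasicoherent
  dualAlg : AlgStr (dual toModFun)
  comul_isAlgHom : IsAlgHomToTilde alg alg (comulHom dualAlg)
  counit_isAlgHom : IsAlgHom alg (scalarsAlg R) (counitHom dualAlg)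

namespace CommBialgFun

variable {R : Type u} [CommRing R]

/-- A morphism of functors of bialgebras: a morphism `f` of functors of modules such that `f` and
`f*` are morphisms of functors of algebras. -/
@[ext]
structure Hom (B C : CommBialgFun R) where
  hom : ModFun.Hom B.toModFun C.toModFun
  isAlgHom : IsAlgHom B.alg C.alg hom
  dual_isAlgHom : IsAlgHom C.dualAlg B.dualAlg (dualMap hom)

instance : Category (CommBialgFun R) where
  Hom := Hom
  id _ := ⟨ModFun.Hom.id _, ⟨fun _ _ _ => rfl, fun _ => rfl⟩, ⟨fun _ _ _ => rfl, fun _ => rfl⟩⟩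
  comp f g :=
    { hom := f.hom.comp g.hom
      isAlgHom :=
        ⟨fun S a b => (congrArg (g.hom.app S) (f.isAlgHom.map_mul S a b)).trans
            (g.isAlgHom.map_mul S _ _),
          fun S => (congrArg (g.hom.app S) (f.isAlgHom.map_one S)).trans (g.isAlgHom.map_one S)⟩
      dual_isAlgHom :=
        ⟨fun S a b => (congrArg ((dualMap f.hom).app S) (g.dual_isAlgHom.map_mul S a b)).trans
            (f.dual_isAlgHom.map_mul S _ _),
          fun S => (congrArg ((dualMap f.hom).app S) (g.dual_isAlgHom.map_one S)).trans
            (f.dual_isAlgHom.map_one S)⟩ }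
  id_comp _ := rfl
  comp_id _ := rfl
  assoc _ _ _ := rfl

end CommBialgFun

section Functions

variable {R : Type u} [CommRing R]

/-- An element of `𝔸_X(S) = ℍom(X, 𝓡)(S) = Hom(X|_S, 𝓡|_S)`: a family of maps `X(T) → T`, one for
each commutative `S`-algebra `S ⟶ T`, compatible with the morphisms of `S`-algebras. -/
@[ext]
structure FunElt (X : CommAlgCat.{u} R ⥤ Type v) (S : CommAlgCat.{u} R) where
  app : ∀ (T : CommAlgCat.{u} R), (S ⟶ T) → X.obj T → T
  naturality : ∀ {T U : CommAlgCat.{u} R} (f : S ⟶ T) (g : T ⟶ U) (x : X.obj T),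
    app U (f ≫ g) (X.map g x) = g.hom (app T f x)

namespace FunElt

variable {X : CommAlgCat.{u} R ⥤ Type v} {S : CommAlgCat.{u} R}

instance : Zero (FunElt X S) := ⟨⟨fun _ _ _ => 0, by simp⟩⟩

instance : One (FunElt X S) := ⟨⟨fun _ _ _ => 1, by simp⟩⟩

instance : Add (FunElt X S) :=
  ⟨fun a b => ⟨fun T f x => a.app T f x + b.app T f x, by simp [a.naturality, b.naturality]⟩⟩

instance : Mul (FunElt X S) :=
  ⟨fun a b => ⟨fun T f x => a.app T f x * b.app T f x, by simp [a.naturality, b.naturality]⟩⟩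

instance : Neg (FunElt X S) :=
  ⟨fun a => ⟨fun T f x => -a.app T f x, by simp [a.naturality]⟩⟩

instance : SMul S (FunElt X S) :=
  ⟨fun s a => ⟨fun T f x => f.hom s * a.app T f x, by simp [a.naturality]⟩⟩

@[simp] lemma zero_app (T : CommAlgCat.{u} R) (f : S ⟶ T) (x : X.obj T) :
    (0 : FunElt X S).app T f x = 0 := rfl
@[simp] lemma one_app (T : CommAlgCat.{u} R) (f : S ⟶ T) (x : X.obj T) :
    (1 : FunElt X S).app T f x = 1 := rfl
@[simp] lemma add_app (a b : FunElt X S) (T : CommAlgCat.{u} R) (f : S ⟶ T) (x : X.obj T) :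
    (a + b).app T f x = a.app T f x + b.app T f x := rfl
@[simp] lemma mul_app (a b : FunElt X S) (T : CommAlgCat.{u} R) (f : S ⟶ T) (x : X.obj T) :
    (a * b).app T f x = a.app T f x * b.app T f x := rfl
@[simp] lemma neg_app (a : FunElt X S) (T : CommAlgCat.{u} R) (f : S ⟶ T) (x : X.obj T) :
    (-a).app T f x = -a.app T f x := rfl
@[simp] lemma smul_app (s : S) (a : FunElt X S) (T : CommAlgCat.{u} R) (f : S ⟶ T)
    (x : X.obj T) : (s • a).app T f x = f.hom s * a.app T f x := rfl

instance : AddCommGroup (FunElt X S) where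
  add_assoc a b c := by ext; simp [add_assoc]
  zero_add a := by ext; simp
  add_zero a := by ext; simp
  add_comm a b := by ext; simp [add_comm]
  neg_add_cancel a := by ext; simp
  nsmul := nsmulRec
  zsmul := zsmulRec

instance : Module S (FunElt X S) where
  one_smul a := by ext; simp
  mul_smul s t a := by ext; simp [mul_assoc]
  smul_zero s := by ext; simp
  smul_add s a b := by ext; simp [mul_add]
  add_smul s t a := by ext; simp [add_mul]
  zero_smul a := by ext; simp

end FunElt

/-- The functor of functions `𝔸_X = ℍom(X, 𝓡)` of a functor of sets `X`. -/
abbrev functions (X : CommAlgCat.{u} R ⥤ Type v) : ModFun.{u, max (u + 1) v} R where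
  obj S := FunElt X S
  map h :=
    { toFun := fun a => ⟨fun T f x => a.app T (h ≫ f) x, fun f g m => by
        rw [← Category.assoc]; exact a.naturality _ _ _⟩
      map_add' := fun _ _ => rfl
      map_smul' := fun _ _ => by ext; simp }
  map_id S a := by
    apply FunElt.ext
    funext T f
    exact congrArg (a.app T) (Category.id_comp f)
  map_comp f g a := by
    apply FunElt.ext
    funext T h
    exact congrArg (a.app T) (Category.assoc f g h)

/-- The (pointwise) algebra structure of `𝔸_X`. -/
def functionsAlg (X : CommAlgCat.{u} R ⥤ Type v) : AlgStr (functions X) where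
  mul S := LinearMap.mk₂ S (fun a b : FunElt X S => a * b)
    (fun a a' b => by ext; simp [add_mul]) (fun s a b => by ext; simp [_root_.mul_assoc])
    (fun a b b' => by ext; simp [mul_add]) (fun s a b => by ext; simp [mul_left_comm])
  one S := (1 : FunElt X S)
  mul_assoc S a b c := by
    apply FunElt.ext; funext T f x; exact _root_.mul_assoc (FunElt.app a T f x) _ _
  one_mul S a := by
    apply FunElt.ext; funext T f x; exact _root_.one_mul (FunElt.app a T f x)
  mul_one S a := by
    apply FunElt.ext; funext T f x; exact _root_.mul_one (FunElt.app a T f x)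
  map_mul f a b := rfl
  map_one f := rfl

/-- The morphism `𝔸_Y → 𝔸_X`, `a ↦ a ∘ h`, induced by `h : X ⟶ Y`. -/
def functionsMap {X Y : CommAlgCat.{u} R ⥤ Type v} (h : X ⟶ Y) :
    ModFun.Hom (functions Y) (functions X) where
  app S :=
    { toFun := fun a : FunElt Y S => (⟨fun T f x => a.app T f (h.app T x), fun f g x => by
        simp [a.naturality, NatTrans.naturality_apply]⟩ : FunElt X S)
      map_add' := fun _ _ => rfl
      map_smul' := fun _ _ => rfl }
  naturality _ _ := rfl

/-- `(Spec A)(S) = ℍom_{𝓡-alg}(A, 𝓡)(S)`, the set of the elements of `A*(S)`, that is, of the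
morphisms `A|_S → 𝓢` of functors of `𝓢`-modules, that are morphisms of functors of algebras (by
adjunction these are the morphisms of functors of `𝓡`-algebras from `A` to the quasi-coherent
algebra associated with `S`). -/
def SpecElt {M : ModFun.{u, v} R} (A : AlgStr M) (S : CommAlgCat.{u} R) :
    Set ((dual M).obj S) :=
  {a : DualElt M S | ∀ (T : CommAlgCat.{u} R) (f : S ⟶ T),
    (∀ x y : M.obj T, a.app T f (A.mul T x y) = a.app T f x * a.app T f y) ∧
      a.app T f (A.one T) = 1}

/-- Evaluation at a point: the canonical map `X(S) → 𝔸_X*(S)`. -/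
def evalPoint (X : CommAlgCat.{u} R ⥤ Type v) (S : CommAlgCat.{u} R) (x : X.obj S) :
    (dual (functions X)).obj S :=
  (⟨fun T f =>
    { toFun := fun a : FunElt X T => a.app T (𝟙 T) (X.map f x)
      map_add' := fun _ _ => rfl
      map_smul' := fun _ _ => rfl }, fun {T U} f g a => by
        change FunElt.app a U (g ≫ 𝟙 U) (X.map (f ≫ g) x) =
          g.hom (FunElt.app a T (𝟙 T) (X.map f x))
        rw [← FunElt.naturality a, Category.comp_id, Category.id_comp, Functor.map_comp]
        rfl⟩ : DualElt (functions X) S)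

lemma evalPoint_mem (X : CommAlgCat.{u} R ⥤ Type v) (S : CommAlgCat.{u} R) (x : X.obj S) :
    evalPoint X S x ∈ SpecElt (functionsAlg X) S :=
  fun _ _ => ⟨fun _ _ => rfl, rfl⟩

/-- A functor of sets `X` is affine if its functor of functions is (well defined as a functor of
sets and) reflexive, and the canonical morphism `X → Spec 𝔸_X` is an isomorphism. -/
structure IsAffineFunctor (X : CommAlgCat.{u} R ⥤ Type u) : Prop where
  small : ∀ S : CommAlgCat.{u} R, Small.{u} ((functions X).obj S)
  reflexive : (functions X).IsReflexive
  bijective : ∀ S : CommAlgCat.{u} R, Function.Bijective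
    (fun x : X.obj S => (⟨evalPoint X S x, evalPoint_mem X S x⟩ : SpecElt (functionsAlg X) S))

/-- The functor of sets underlying a functor of monoids. -/
abbrev underlying (G : CommAlgCat.{u} R ⥤ MonCat.{u}) : CommAlgCat.{u} R ⥤ Type u :=
  G ⋙ forget MonCat.{u}

variable (R) in
/-- The category of affine functors of monoids: the full subcategory of the category of functors
of monoids on the commutative `R`-algebras whose underlying functor of sets is affine. -/
abbrev AffineMonoidFun :=
  ObjectProperty.FullSubcategory
    (fun G : CommAlgCat.{u} R ⥤ MonCat.{u} => IsAffineFunctor (underlying G))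

/-- `i : B → 𝔸_G` exhibits the functor of commutative bialgebras `B` as `𝔸_G`: it is an isomorphism
of functors of algebras, and through its dual the canonical map `G → 𝔸_G* = B*` is a morphism of
functors of monoids, where `B*` is regarded as a functor of monoids by its multiplication. -/
structure IsFunctionBialgebra (G : CommAlgCat.{u} R ⥤ MonCat.{u}) (B : CommBialgFun R)
    (i : ModFun.Hom B.toModFun (functions (underlying G))) : Prop where
  isAlgHom : IsAlgHom B.alg (functionsAlg (underlying G)) i
  bijective : i.Bijective
  evalPoint_mul : ∀ (S : CommAlgCat.{u} R) (g h : G.obj S),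
    (dualMap i).app S (evalPoint (underlying G) S (g * h : G.obj S)) =
      B.dualAlg.mul S ((dualMap i).app S (evalPoint (underlying G) S g))
        ((dualMap i).app S (evalPoint (underlying G) S h))
  evalPoint_one : ∀ S : CommAlgCat.{u} R,
    (dualMap i).app S (evalPoint (underlying G) S (1 : G.obj S)) = B.dualAlg.one S

end Functions

/-! Everything rests on one consequence of reflexivity over a field. Given `m ∈ M(S)` and a linear
form `l` on `S`, the rule `w ↦ (id ⊗ l)(w(m))` is an element of `M**(K)`, so it is evaluation at
some `m' ∈ M(K)` (`IsReflexive.exists_contract`). Linear forms on `S` and on `V` together separate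
the elements of `S ⊗ V`. Hence a morphism from a reflexive `M` to a quasi-coherent module that
vanishes on `M(K)` is zero (`IsReflexive.hom_eq_zero`).

A `T`-valued point of `Spec A` amounts to a morphism of algebras `M → 𝓣`. Its values on `M(K)` form
a subalgebra `W` of `T`. The composite `M → 𝓣 → 𝓣/𝓦` vanishes on `M(K)`, hence everywhere, so the
point factors through a quasi-coherent quotient with algebra `W` (`pointQuotient`). Thus `Spec A` is
the union of the spectra of the quasi-coherent quotients. A function on it is the same as a
compatible family of elements of these quotients: evaluate the function at the universal points, or
read the family at a point through the quotient attached to that point. So, for `M` reflexive and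
`A` commutative, `M → 𝔸_{Spec A}` is an isomorphism exactly when `A` is pro-quasicoherent
(`SpecModel.evalHom_bijective`, `SpecModel.isProQuasicoherent`).

For an affine functor of monoids `G`, the dual `𝔸_G*` carries the convolution `(ab)(F) = a(g ↦ b(h ↦
F(gh)))`. Followed by the projection to `𝓑 ⊗ 𝓑'`, the dual comultiplication is evaluation at the
product in `G(B ⊗ B')` of the two universal points. That product is again a point, so the composite
is a morphism of algebras (`comulHom_isAlgHomToTilde`). The counit is evaluation at the unit point.

Conversely, let `B` be a functor of commutative bialgebras. Two points factor through quotients, and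
the axiom on the comultiplication makes their product in `B*` a point
(`CommBialgFun.mul_mem_specElt`), so `Spec B` is a functor of monoids. It is small because an
element of `B*(T)` is determined by its values on `B(K)`. The isomorphism `B ≅ 𝔸_{Spec B}` also
respects the products on the duals: by reflexivity `a ↦ (ac)(m)` is evaluation at an element of `B`,
which lets the product of `B*` be computed as a convolution
(`CommBialgFun.dualMap_evalHom_isAlgHom`).

This gives essential surjectivity. Full faithfulness comes from `G ≅ Spec 𝔸_G`: for a morphism of
bialgebras `f`, the dual `f*` sends characters to characters because `f` is multiplicative, and is a
morphism of monoids on them because `f*` is multiplicative. As `𝔸_G` takes values in a larger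
universe, a small model of it is used throughout. -/

namespace ModFun

universe v₁ v₂ v₃

/-! ### Inverses of isomorphisms and invariance of reflexivity. -/

section Inverse

variable {R : Type u} [CommRing R] {M : ModFun.{u, v₁} R} {N : ModFun.{u, v₂} R}

/-- The inverse of a bijective morphism of functors of modules. -/
noncomputable def Hom.inverse (f : Hom M N) (hf : f.Bijective) : Hom N M where
  app S := (LinearEquiv.ofBijective (f.app S) (hf S)).symm.toLinearMap
  naturality {S T} h n := by
    apply (hf T).1
    have key (U) (x : N.obj U) :
        f.app U ((LinearEquiv.ofBijective (f.app U) (hf U)).symm.toLinearMap x) = x :=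
      (LinearEquiv.ofBijective (f.app U) (hf U)).apply_symm_apply x
    rw [key, f.naturality, key]

@[simp] lemma Hom.app_inverse (f : Hom M N) (hf : f.Bijective) (S) (n : N.obj S) :
    f.app S ((f.inverse hf).app S n) = n :=
  (LinearEquiv.ofBijective (f.app S) (hf S)).apply_symm_apply n

@[simp] lemma Hom.inverse_app (f : Hom M N) (hf : f.Bijective) (S) (m : M.obj S) :
    (f.inverse hf).app S (f.app S m) = m :=
  (LinearEquiv.ofBijective (f.app S) (hf S)).symm_apply_apply m

lemma Hom.inverse_bijective (f : Hom M N) (hf : f.Bijective) : (f.inverse hf).Bijective :=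
  fun S => (LinearEquiv.ofBijective (f.app S) (hf S)).symm.bijective

@[simp] lemma Hom.comp_app {P : ModFun.{u, v₃} R} (f : Hom M N) (g : Hom N P) (S) (m : M.obj S) :
    (f.comp g).app S m = g.app S (f.app S m) := rfl

lemma dualMap_app_app (f : Hom M N) (S : CommAlgCat.{u} R) (a : DualElt N S) (T) (h : S ⟶ T)
    (m : M.obj T) :
    DualElt.app ((dualMap f).app S a) T h m = a.app T h (f.app T m) := rfl

lemma dual_map_app (S T : CommAlgCat.{u} R) (h : S ⟶ T) (a : DualElt M S) (U) (g : T ⟶ U)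
    (m : M.obj U) :
    DualElt.app ((dual M).map h a) U g m = a.app U (h ≫ g) m := rfl

lemma dualMap_bijective (f : Hom M N) (hf : f.Bijective) : (dualMap f).Bijective := by
  intro S
  refine ⟨fun a b hab => ?_, fun a => ⟨(dualMap (f.inverse hf)).app S a, ?_⟩⟩
  · apply DualElt.ext
    funext T h
    ext n
    have := congrArg (fun c : DualElt M S => c.app T h ((f.inverse hf).app T n)) hab
    change DualElt.app a T h (f.app T _) = DualElt.app b T h (f.app T _) at this
    rwa [f.app_inverse hf] at this
  · apply DualElt.ext
    funext T h
    ext m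
    exact congrArg (DualElt.app a T h) (f.inverse_app hf T m)

/-- The canonical morphism to the bidual is natural in the module, and `f**` is bijective when `f`
is. -/
lemma IsReflexive.of_bijective (f : Hom M N) (hf : f.Bijective) (hM : M.IsReflexive) :
    N.IsReflexive := by
  intro S
  have h : ⇑((toBidual N).app S) ∘ f.app S =
      (dualMap (dualMap f)).app S ∘ (toBidual M).app S := by
    funext m
    apply DualElt.ext
    funext T g
    ext a
    change DualElt.app a T (𝟙 T) (N.map g (f.app S m)) =
      DualElt.app a T (𝟙 T) (f.app T (M.map g m))
    rw [f.naturality]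
  rw [← (hf S).of_comp_iff, h]
  exact (dualMap_bijective _ (dualMap_bijective f hf) S).comp (hM S)

end Inverse

/-! ### Small models of functors of modules. -/

section ShrinkFunctor

variable {R : Type u} [CommRing R] (M : ModFun.{u, v} R) [∀ S, Small.{w} (M.obj S)]

/-- A functor of modules with small values, moved to a smaller universe. -/
noncomputable def shrink : ModFun.{u, w} R where
  obj S := Shrink.{w} (M.obj S)
  map {S T} f :=
    { toFun := fun m => equivShrink _ (M.map f ((equivShrink _).symm m))
      map_add' := fun a b => by simp [equivShrink_add, equivShrink_symm_add]
      map_smul' := fun s a => by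
        rw [equivShrink_symm_smul, LinearMap.map_smulₛₗ, equivShrink_smul] }
  map_id S m := by
    change equivShrink _ (M.map (𝟙 S) ((equivShrink _).symm m)) = m
    rw [M.map_id, Equiv.apply_symm_apply]
  map_comp f g m := by simp [M.map_comp]

/-- The canonical isomorphism from the small model. -/
noncomputable def ofShrink : Hom (shrink.{u, v, w} M) M where
  app S := (Shrink.linearEquiv S (M.obj S)).toLinearMap
  naturality _ _ := (equivShrink _).symm_apply_apply _

lemma ofShrink_bijective : (ofShrink.{u, v, w} M).Bijective :=
  fun S => (Shrink.linearEquiv S (M.obj S)).bijective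

end ShrinkFunctor

end ModFun

/-! ### Transport of algebra structures. -/

section Transport

universe v₁ v₂ v₃

variable {R : Type u} [CommRing R] {M : ModFun.{u, v₁} R} {N : ModFun.{u, v₂} R}

lemma IsAlgHom.comp {P : ModFun.{u, v₃} R} {A : AlgStr M} {B : AlgStr N} {C : AlgStr P}
    {f : Hom M N} {g : Hom N P} (hf : IsAlgHom A B f) (hg : IsAlgHom B C g) :
    IsAlgHom A C (f.comp g) :=
  ⟨fun S a b => by simp [hf.map_mul, hg.map_mul], fun S => by simp [hf.map_one, hg.map_one]⟩

lemma IsAlgHom.inverse {A : AlgStr M} {B : AlgStr N} {f : Hom M N} (h : IsAlgHom A B f)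
    (hf : f.Bijective) : IsAlgHom B A (f.inverse hf) :=
  ⟨fun S a b => (hf S).1 (by simp [h.map_mul]), fun S => (hf S).1 (by simp [h.map_one])⟩

/-- The algebra structure on `M` transported along an isomorphism `M → N`. -/
noncomputable def AlgStr.transport (B : AlgStr N) (f : Hom M N) (hf : f.Bijective) : AlgStr M where
  mul S := ((B.mul S).compl₁₂ (f.app S) (f.app S)).compr₂ ((f.inverse hf).app S)
  one S := (f.inverse hf).app S (B.one S)
  mul_assoc S a b c := by simp [B.mul_assoc]
  one_mul S a := by simp [B.one_mul]
  mul_one S a := by simp [B.mul_one]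
  map_mul g a b := by
    simp [← (f.inverse hf).naturality, B.map_mul, f.naturality]
  map_one g := by rw [← (f.inverse hf).naturality, B.map_one]

lemma AlgStr.transport_isAlgHom (B : AlgStr N) (f : Hom M N) (hf : f.Bijective) :
    IsAlgHom (B.transport f hf) B f :=
  ⟨fun S a b => by simp [AlgStr.transport], fun S => by simp [AlgStr.transport]⟩

end Transport

/-! ### Dual elements as morphisms to quasi-coherent modules. -/

section QuasiCoherentDual

variable {R : Type u} [CommRing R]

/-- The tensor product of two commutative algebras. -/
def algTensor (S T : CommAlgCat.{u} R) : CommAlgCat.{u} R := CommAlgCat.of R (S ⊗[R] T)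

/-- The left inclusion into the tensor product of two commutative algebras. -/
def algInl (S T : CommAlgCat.{u} R) : S ⟶ algTensor S T :=
  CommAlgCat.ofHom Algebra.TensorProduct.includeLeft

/-- The right inclusion into the tensor product of two commutative algebras. -/
def algInr (S T : CommAlgCat.{u} R) : T ⟶ algTensor S T :=
  CommAlgCat.ofHom Algebra.TensorProduct.includeRight

/-- The morphism from a tensor product of commutative algebras given by two morphisms. -/
noncomputable def algDesc {S T U : CommAlgCat.{u} R} (f : S ⟶ U) (g : T ⟶ U) : algTensor S T ⟶ U :=
  CommAlgCat.ofHom (Algebra.TensorProduct.productMap f.hom g.hom)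

/-- The structure morphism of a commutative algebra. -/
def algInit (S : CommAlgCat.{u} R) : CommAlgCat.of R R ⟶ S := CommAlgCat.ofHom (Algebra.ofId R S)

lemma algInit_unique {S : CommAlgCat.{u} R} (f g : CommAlgCat.of R R ⟶ S) : f = g :=
  CommAlgCat.hom_ext (Subsingleton.elim (α := R →ₐ[R] S) _ _)

variable {S T U V : CommAlgCat.{u} R}

/-- The identification of `algTensor S T` with `S ⊗[R] T`. -/
def algUntensor (S T : CommAlgCat.{u} R) : algTensor S T ≃ₐ[R] S ⊗[R] T := AlgEquiv.refl

/-- The algebra morphism from `S ⊗[R] T` given by two morphisms. -/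
noncomputable abbrev descHom (f : S ⟶ U) (g : T ⟶ U) : S ⊗[R] T →ₐ[R] U :=
  Algebra.TensorProduct.productMap f.hom g.hom

lemma algDesc_apply (f : S ⟶ U) (g : T ⟶ U) (x : algTensor S T) :
    (algDesc f g).hom x = descHom f g (algUntensor S T x) := rfl

lemma algInl_desc (f : S ⟶ U) (g : T ⟶ U) : algInl S T ≫ algDesc f g = f := by
  ext x
  exact (Algebra.TensorProduct.productMap_left_apply _ _ x)

lemma algInr_desc (f : S ⟶ U) (g : T ⟶ U) : algInr S T ≫ algDesc f g = g := by
  ext x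
  exact (Algebra.TensorProduct.productMap_right_apply _ _ x)

@[simp] lemma descHom_inl_inr (x : S ⊗[R] T) :
    descHom (algInl S T) (algInr S T) x = (algUntensor S T).symm x := by
  have : descHom (algInl S T) (algInr S T) = (algUntensor S T).symm.toAlgHom := by
    ext x
    · exact Algebra.TensorProduct.productMap_left_apply _ _ x
    · exact Algebra.TensorProduct.productMap_right_apply _ _ x
  rw [this]
  rfl

lemma hom_descHom (f : S ⟶ U) (g : T ⟶ U) (h : U ⟶ V) (x : S ⊗[R] T) :
    h.hom (descHom f g x) = descHom (f ≫ h) (g ≫ h) x := by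
  induction x with
  | zero => simp
  | add x y hx hy => simp only [map_add, hx, hy]
  | tmul s t => simp

lemma descHom_map (h : S ⟶ V) (f : V ⟶ U) (g : T ⟶ U) (x : S ⊗[R] T) :
    descHom f g ((quasiCoherent R T).map h x) = descHom (h ≫ f) g x := by
  induction x with
  | zero => simp
  | add x y hx hy => rw [map_add, map_add, hx, hy, map_add]
  | tmul s t =>
    change descHom f g (h.hom s ⊗ₜ[R] t) = _
    simp

/-- The morphism of quasi-coherent modules induced by a linear map. -/
noncomputable def quasiCoherentMap {A B : Type u} [AddCommGroup A] [Module R A] [AddCommGroup B]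
    [Module R B] (l : A →ₗ[R] B) : Hom (quasiCoherent R A) (quasiCoherent R B) where
  app S := l.baseChange S
  naturality {S T} f x := by
    change S ⊗[R] A at x
    induction x with
    | zero => simp
    | add x y hx hy => simp only [map_add, hx, hy]
    | tmul s a => rfl

@[simp] lemma quasiCoherentMap_tmul {A B : Type u} [AddCommGroup A] [Module R A] [AddCommGroup B]
    [Module R B] (l : A →ₗ[R] B) (s : S) (a : A) :
    (quasiCoherentMap l).app S (s ⊗ₜ[R] a) = s ⊗ₜ[R] l a := rfl

lemma quasiCoherentMap_isAlgHom {A B : Type u} [Ring A] [Algebra R A] [Ring B]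
    [Algebra R B] (l : A →ₐ[R] B) :
    IsAlgHom (quasiCoherentAlg R A) (quasiCoherentAlg R B) (quasiCoherentMap l.toLinearMap) :=
  ⟨fun S => map_mul (Algebra.TensorProduct.map (AlgHom.id S S) l),
    fun S => map_one (Algebra.TensorProduct.map (AlgHom.id S S) l)⟩

lemma descHom_quasiCoherentMap (f : S ⟶ U) (h : V ⟶ T) (g : T ⟶ U) (x : S ⊗[R] V) :
    descHom f g ((quasiCoherentMap h.hom.toLinearMap).app S x) = descHom f (h ≫ g) x := by
  induction x with
  | zero => simp
  | add x y hx hy => rw [map_add, map_add, hx, hy, map_add]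
  | tmul s t =>
    rw [quasiCoherentMap_tmul]
    simp

variable {M : ModFun.{u, v} R}

namespace ModFun

/-- The pair `(k, f)` factors through the coproduct `S ⊗ T`, so by naturality the single value over
`S ⊗ T` determines all values of `a` on base changes of `m`. This is what turns an element of
`M*(T)` into a morphism `M → 𝓣`. -/
lemma DualElt.app_map_eq_descHom (a : DualElt M T) (k : S ⟶ U) (f : T ⟶ U) (m : M.obj S) :
    a.app U f (M.map k m) = descHom k f
      (algUntensor S T (a.app (algTensor S T) (algInr S T) (M.map (algInl S T) m))) := by
  have h := a.naturality (algInr S T) (algDesc k f) (M.map (algInl S T) m)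
  rwa [← M.map_comp, algInl_desc, algInr_desc] at h

/-- The morphism `M → 𝓣` associated with an element of `M*(T)`. -/
noncomputable def DualElt.toHom (a : DualElt M T) : Hom M (quasiCoherent R T) where
  app S :=
    { toFun := fun m =>
        algUntensor S T (a.app (algTensor S T) (algInr S T) (M.map (algInl S T) m))
      map_add' := fun m n => by rw [map_add, map_add, map_add]
      map_smul' := fun s m => by
        rw [LinearMap.map_smulₛₗ, map_smul, smul_eq_mul, map_mul]
        exact (Algebra.smul_def (A := S ⊗[R] T) s _).symm }
  naturality {S U} f m := by
    change algUntensor U T (a.app (algTensor U T) (algInr U T) (M.map (algInl U T) (M.map f m))) =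
      (quasiCoherent R T).map f
        (algUntensor S T (a.app (algTensor S T) (algInr S T) (M.map (algInl S T) m)))
    rw [← M.map_comp, DualElt.app_map_eq_descHom, ← descHom_map, descHom_inl_inr,
      AlgEquiv.apply_symm_apply]

lemma DualElt.toHom_app (a : DualElt M T) (m : M.obj S) : a.toHom.app S m =
    algUntensor S T (a.app (algTensor S T) (algInr S T) (M.map (algInl S T) m)) := rfl

lemma DualElt.app_map (a : DualElt M T) (k : S ⟶ U) (f : T ⟶ U) (m : M.obj S) :
    a.app U f (M.map k m) = descHom k f (a.toHom.app S m) :=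
  a.app_map_eq_descHom k f m

/-- With `k` the identity, this recovers `a` from the associated morphism `M → 𝓣`. -/
lemma DualElt.app_eq (a : DualElt M T) (f : T ⟶ U) (m : M.obj U) :
    a.app U f m = descHom (𝟙 U) f (a.toHom.app U m) := by
  rw [← a.app_map, M.map_id]

/-- The element of `M*(T)` associated with a morphism `M → 𝓣`. -/
noncomputable def Hom.toDualElt (φ : Hom M (quasiCoherent R T)) : DualElt M T where
  app U f :=
    { toFun := fun m => descHom (𝟙 U) f (φ.app U m)
      map_add' := fun m n => by rw [map_add, map_add]
      map_smul' := fun s m => by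
        rw [map_smul, Algebra.smul_def, map_mul]
        exact congrArg (· * _) (Algebra.TensorProduct.productMap_left_apply _ _ s) }
  naturality {U V} f g m := by
    change descHom (𝟙 V) (f ≫ g) (φ.app V (M.map g m)) = g.hom (descHom (𝟙 U) f (φ.app U m))
    rw [φ.naturality, descHom_map, hom_descHom, Category.id_comp, Category.comp_id]

lemma Hom.toDualElt_app (φ : Hom M (quasiCoherent R T)) (f : T ⟶ U) (m : M.obj U) :
    φ.toDualElt.app U f m = descHom (𝟙 U) f (φ.app U m) := rfl

lemma Hom.toDualElt_app_map (φ : Hom M (quasiCoherent R T)) (k : S ⟶ U) (f : T ⟶ U)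
    (m : M.obj S) : φ.toDualElt.app U f (M.map k m) = descHom k f (φ.app S m) := by
  rw [toDualElt_app, φ.naturality, descHom_map, Category.comp_id]

end ModFun

/-- Together with `toDualElt_mem`, this lets points of the spectrum over `T` be handled as morphisms
of algebras to the quasi-coherent algebra of `T`. -/
lemma toHom_isAlgHom {A : AlgStr M} {a : DualElt M T} (ha : a ∈ SpecElt A T) :
    IsAlgHom A (quasiCoherentAlg R T) a.toHom := by
  refine ⟨fun S x y => ?_, fun S => ?_⟩
  · rw [DualElt.toHom_app, A.map_mul, (ha _ _).1, map_mul]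
    rfl
  · rw [DualElt.toHom_app, A.map_one, (ha _ _).2, map_one]
    rfl

lemma toDualElt_mem {A : AlgStr M} {φ : Hom M (quasiCoherent R T)}
    (hφ : IsAlgHom A (quasiCoherentAlg R T) φ) : φ.toDualElt ∈ SpecElt A T := by
  refine fun U f => ⟨fun x y => ?_, ?_⟩
  · rw [Hom.toDualElt_app, hφ.map_mul]
    exact map_mul (descHom (𝟙 U) f) _ _
  · rw [Hom.toDualElt_app, hφ.map_one]
    exact map_one (descHom (𝟙 U) f)

lemma map_mem_specElt {A : AlgStr M} {a : DualElt M S} (ha : a ∈ SpecElt A S) (f : S ⟶ T) :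
    (dual M).map f a ∈ SpecElt A T :=
  fun U g => ha U (f ≫ g)

/-- Contraction of the second factor of `T ⊗ V` with a linear form on `V`. -/
noncomputable def contract {V : Type u} [AddCommGroup V] [Module R V] (l : V →ₗ[R] R)
    (T : CommAlgCat.{u} R) : T ⊗[R] V →ₗ[T] T :=
  (AlgebraTensorModule.rid R T T).toLinearMap.comp (l.baseChange T)

@[simp] lemma contract_tmul {V : Type u} [AddCommGroup V] [Module R V] (l : V →ₗ[R] R)
    (t : T) (v : V) : contract l T (t ⊗ₜ[R] v) = l v • t := by
  simp [contract]

lemma contract_map {V : Type u} [AddCommGroup V] [Module R V] (l : V →ₗ[R] R)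
    (f : S ⟶ T) (x : S ⊗[R] V) :
    contract l T ((quasiCoherent R V).map f x) = f.hom (contract l S x) := by
  induction x with
  | zero => simp
  | add x y hx hy => simp only [map_add, hx, hy]
  | tmul s v =>
    change contract l T (f.hom s ⊗ₜ[R] v) = _
    simp

end QuasiCoherentDual

/-! ### Factorization through an injective morphism. -/

section Lift

universe v₁ v₂ v₃

variable {R : Type u} [CommRing R] {M : ModFun.{u, v₁} R} {N : ModFun.{u, v₂} R}
  {P : ModFun.{u, v₃} R}

/-- Factorization of a morphism through an injective one. -/
noncomputable def ModFun.Hom.liftOfInjective (φ : Hom M N) (i : Hom P N)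
    (hi : ∀ S, Function.Injective (i.app S))
    (h : ∀ S (m : M.obj S), φ.app S m ∈ LinearMap.range (i.app S)) : Hom M P where
  app S := (LinearEquiv.ofInjective (i.app S) (hi S)).symm.toLinearMap.comp
    ((φ.app S).codRestrict _ (h S))
  naturality {S T} f m := by
    have key (U) (x : M.obj U) : i.app U (((LinearEquiv.ofInjective (i.app U)
        (hi U)).symm.toLinearMap.comp ((φ.app U).codRestrict _ (h U))) x) = φ.app U x :=
      congrArg Subtype.val ((LinearEquiv.ofInjective (i.app U) (hi U)).apply_symm_apply _)
    apply hi T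
    rw [key, φ.naturality, i.naturality, key]

@[simp] lemma ModFun.Hom.app_liftOfInjective (φ : Hom M N) (i : Hom P N)
    (hi : ∀ S, Function.Injective (i.app S))
    (h : ∀ S (m : M.obj S), φ.app S m ∈ LinearMap.range (i.app S)) (S) (m : M.obj S) :
    i.app S ((φ.liftOfInjective i hi h).app S m) = φ.app S m :=
  congrArg Subtype.val ((LinearEquiv.ofInjective (i.app S) (hi S)).apply_symm_apply _)

end Lift

/-! ### Reflexive functors over a field: points factor through quasi-coherent quotients. -/

section Field

variable {K : Type u} [Field K] {M : ModFun.{u, v} K} {S T U : CommAlgCat.{u} K}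

namespace ModFun

/-- The element of `M**(K)` given by an element of `M(S)` and a linear form on `S`. -/
noncomputable def bidualContract (m : M.obj S) (l : S →ₗ[K] K) :
    DualElt (dual M) (CommAlgCat.of K K) where
  app T _ :=
    { toFun := fun a : DualElt M T => contract l T
        (algUntensor T S (a.app (algTensor T S) (algInl T S) (M.map (algInr T S) m)))
      map_add' := fun a b => by
        rw [DualElt.add_app, LinearMap.add_apply, map_add, map_add]
      map_smul' := fun t a => by
        rw [DualElt.smul_app, LinearMap.smul_apply, smul_eq_mul, map_mul]
        exact (congrArg (contract l T) (Algebra.smul_def (A := T ⊗[K] S) t _).symm).trans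
          (map_smul (contract l T) t _) }
  naturality {T U} f g a := by
    change contract l U (algUntensor U S (DualElt.app a (algTensor U S) (g ≫ algInl U S)
        (M.map (algInr U S) m))) =
      g.hom (contract l T (algUntensor T S (DualElt.app a (algTensor T S) (algInl T S)
        (M.map (algInr T S) m))))
    have h := DualElt.naturality a (algInl T S) (algDesc (g ≫ algInl U S) (algInr U S))
      (M.map (algInr T S) m)
    rw [← M.map_comp, algInl_desc, algInr_desc, algDesc_apply, ← descHom_map,
      descHom_inl_inr] at h
    rw [h, AlgEquiv.apply_symm_apply, contract_map]

/-- Reflexivity represents `bidualContract m l`, an element of `M**(K)`, by an element of `M(K)`. It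
allows an element of `M(S)` to be tested by elements of `M(K)`. -/
lemma IsReflexive.exists_contract (hM : M.IsReflexive) (m : M.obj S) (l : S →ₗ[K] K) :
    ∃ m' : M.obj (CommAlgCat.of K K), ∀ a : DualElt M (CommAlgCat.of K K),
      a.app _ (𝟙 _) m' = l (a.app S (algInit S) m) := by
  obtain ⟨m', hm'⟩ := (hM (CommAlgCat.of K K)).2 (bidualContract m l)
  refine ⟨m', fun a => ?_⟩
  have h := congrArg (fun z : DualElt (dual M) (CommAlgCat.of K K) => z.app _ (𝟙 _) a) hm'
  change a.app _ (𝟙 _) (M.map (𝟙 _) m') = contract l _ (algUntensor _ S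
    (a.app (algTensor _ S) (algInl _ S) (M.map (algInr _ S) m))) at h
  rw [M.map_id] at h
  rw [h]
  -- The contraction at the base field takes place in `K ⊗ S`; naturality along `K ⊗ S → S` replaces
  -- it by `l` on `S`.
  have h' := a.naturality (algInl _ S) (algDesc (algInit S) (𝟙 S)) (M.map (algInr _ S) m)
  rw [← M.map_comp, algInl_desc, algInr_desc, algDesc_apply, M.map_id] at h'
  rw [h']
  generalize algUntensor _ S (a.app (algTensor _ S) (algInl _ S) (M.map (algInr _ S) m)) = x
  induction x with
  | zero => simp
  | add x y hx hy => simp only [map_add, hx, hy]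
  | tmul k s =>
    rw [contract_tmul, Algebra.TensorProduct.productMap_apply_tmul]
    change l s * k = l (algebraMap K S k * s)
    rw [← Algebra.smul_def, map_smul, smul_eq_mul, mul_comm]

/-- The linear form on `M` obtained from a morphism to a quasi-coherent module. -/
noncomputable def Hom.contractDual {V : Type u} [AddCommGroup V] [Module K V]
    (φ : Hom M (quasiCoherent K V)) (l : V →ₗ[K] K) : DualElt M (CommAlgCat.of K K) where
  app T _ := (contract l T).comp (φ.app T)
  naturality {T U} f g m := by
    change contract l U (φ.app U (M.map g m)) = g.hom (contract l T (φ.app T m))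
    rw [φ.naturality, contract_map]

/-- The coordinates of `x` in the `S`-basis induced by a `K`-basis of `V` are its contractions with
the coordinate forms. -/
lemma contract_ext {V : Type u} [AddCommGroup V] [Module K V] {x : S ⊗[K] V}
    (h : ∀ l : V →ₗ[K] K, contract l S x = 0) : x = 0 := by
  let b := Module.Basis.ofVectorSpace K V
  apply (b.baseChange S).ext_elem
  intro i
  rw [map_zero, Finsupp.zero_apply, ← h (b.coord i)]
  clear h
  induction x with
  | zero => simp
  | add x y hx hy => simp only [map_add, Finsupp.add_apply, hx, hy]
  | tmul s v => simp [Module.Basis.baseChange_repr_tmul]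

/-- A morphism from a reflexive functor to a quasi-coherent one is determined by its value at the
base field. -/
theorem IsReflexive.hom_eq_zero (hM : M.IsReflexive) {V : Type u} [AddCommGroup V] [Module K V]
    (φ : Hom M (quasiCoherent K V))
    (h : ∀ m : M.obj (CommAlgCat.of K K), φ.app _ m = 0) (S) (m : M.obj S) : φ.app S m = 0 := by
  -- Linear forms `l` on `V` and `r` on `S` suffice to detect `φ(m)`; for each pair, `r(l(φ(m)))`
  -- equals the value of `l ∘ φ` at an element of `M(K)`.
  apply contract_ext
  intro l
  rw [← Module.forall_dual_apply_eq_zero_iff K]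
  intro r
  obtain ⟨m', hm'⟩ := hM.exists_contract m r
  have := hm' (φ.contractDual l)
  change contract l _ (φ.app _ m') = r (contract l S (φ.app S m)) at this
  rw [← this, h, map_zero]

/-- The value at the base field of the morphism attached to a point. -/
lemma DualElt.toHom_app_map_init (a : DualElt M T) (m : M.obj (CommAlgCat.of K K)) (S) :
    a.toHom.app S (M.map (algInit S) m) = 1 ⊗ₜ[K] a.app T (𝟙 T) (M.map (algInit T) m) := by
  rw [DualElt.toHom_app, ← M.map_comp, algInit_unique (algInit S ≫ algInl S T)
    (algInit T ≫ algInr S T), M.map_comp]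
  have := a.naturality (𝟙 T) (algInr S T) (M.map (algInit T) m)
  rw [Category.id_comp] at this
  rw [this]
  rfl

lemma DualElt.toHom_app_base (a : DualElt M T) (m : M.obj (CommAlgCat.of K K)) :
    a.toHom.app _ m = 1 ⊗ₜ[K] a.app T (𝟙 T) (M.map (algInit T) m) := by
  have := a.toHom_app_map_init m (CommAlgCat.of K K)
  rwa [algInit_unique (algInit (CommAlgCat.of K K)) (𝟙 _), M.map_id] at this

/-- The morphism `M → 𝓣` attached to `a - b` vanishes on `M(K)`, hence everywhere by
`IsReflexive.hom_eq_zero`. -/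
lemma IsReflexive.dualElt_ext (hM : M.IsReflexive) {a b : DualElt M T}
    (h : ∀ m : M.obj (CommAlgCat.of K K),
      a.app T (𝟙 T) (M.map (algInit T) m) = b.app T (𝟙 T) (M.map (algInit T) m)) : a = b := by
  rw [← sub_eq_zero]
  have key : ∀ S (m : M.obj S), (a - b).toHom.app S m = 0 := by
    apply hM.hom_eq_zero
    intro m
    rw [DualElt.toHom_app_base, sub_eq_add_neg, DualElt.add_app, DualElt.neg_app,
      LinearMap.add_apply, LinearMap.neg_apply, h, add_neg_cancel, tmul_zero]
  apply DualElt.ext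
  funext U f
  ext m
  rw [DualElt.app_eq, key, map_zero]
  rfl

/-- A dual element ranges a priori over all commutative algebras, but it is determined by a function
`M(K) → T`. This keeps `Spec` in the original universe. -/
lemma IsReflexive.small_dualElt {M : ModFun.{u, u} K} (hM : M.IsReflexive) (T) :
    Small.{u} (DualElt M T) :=
  small_of_injective (β := M.obj (CommAlgCat.of K K) → T)
    (f := fun a m => a.app T (𝟙 T) (M.map (algInit T) m))
    fun _ _ h => hM.dualElt_ext (congrFun h)

end ModFun

variable {A : AlgStr M}

/-- The algebra of the values at a point of the elements of `M(K)`. -/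
noncomputable def pointAlgebra (a : DualElt M T) (ha : a ∈ SpecElt A T) : Subalgebra K T where
  carrier := Set.range fun m : M.obj (CommAlgCat.of K K) => a.app T (𝟙 T) (M.map (algInit T) m)
  mul_mem' := by
    rintro _ _ ⟨m, rfl⟩ ⟨n, rfl⟩
    exact ⟨A.mul _ m n, by simp only [A.map_mul, (ha T (𝟙 T)).1]⟩
  add_mem' := by
    rintro _ _ ⟨m, rfl⟩ ⟨n, rfl⟩
    exact ⟨m + n, by simp only [map_add]⟩
  algebraMap_mem' k := by
    refine ⟨A.unitHom.app (CommAlgCat.of K K) k, ?_⟩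
    change a.app T (𝟙 T) (M.map (algInit T) (A.unitHom.app (CommAlgCat.of K K) k)) = _
    rw [← A.unitHom.naturality]
    change a.app T (𝟙 T) (algebraMap K T k • A.one T) = _
    rw [map_smul, (ha T (𝟙 T)).2, smul_eq_mul, mul_one]

/-- The inclusion of the algebra of values at a point. -/
noncomputable def pointAlgebraVal (a : DualElt M T) (ha : a ∈ SpecElt A T) :
    CommAlgCat.of K (pointAlgebra a ha) ⟶ T := CommAlgCat.ofHom (pointAlgebra a ha).val

/-- Let `W ⊆ T` be the values on `M(K)`. The composite to the quasi-coherent module of `T/W`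
vanishes on `M(K)`, hence everywhere, and exactness of `S ⊗ W → S ⊗ T → S ⊗ T/W` puts the values in
`S ⊗ W`. -/
lemma toHom_mem_range (hM : M.IsReflexive) (a : DualElt M T) (ha : a ∈ SpecElt A T) (S)
    (m : M.obj S) : a.toHom.app S m ∈
      LinearMap.range ((quasiCoherentMap (pointAlgebra a ha).val.toLinearMap).app S) := by
  let W := Subalgebra.toSubmodule (pointAlgebra a ha)
  have h0 := hM.hom_eq_zero (a.toHom.comp (quasiCoherentMap W.mkQ)) (fun m => by
    rw [Hom.comp_app, DualElt.toHom_app_base, quasiCoherentMap_tmul, Submodule.mkQ_apply,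
      (Submodule.Quotient.mk_eq_zero W (x := a.app T (𝟙 T) (M.map (algInit T) m))).2 ⟨m, rfl⟩,
      tmul_zero]) S m
  have hex : Function.Exact (W.subtype.lTensor S) (W.mkQ.lTensor S) :=
    lTensor_exact S (LinearMap.exact_subtype_mkQ W) W.mkQ_surjective
  exact (hex _).1 h0

lemma quasiCoherentMap_injective {V W : Type u} [AddCommGroup V] [Module K V] [AddCommGroup W]
    [Module K W] {l : V →ₗ[K] W} (hl : Function.Injective l) (S) :
    Function.Injective ((quasiCoherentMap l).app S) :=
  Module.Flat.lTensor_preserves_injective_linearMap (M := S) l hl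

/-- The quasi-coherent algebra quotient through which a point factors. -/
noncomputable def pointQuotient (hM : M.IsReflexive) (a : DualElt M T) (ha : a ∈ SpecElt A T) :
    QCQuotient A :=
  have hinj := quasiCoherentMap_injective (l := (pointAlgebra a ha).val.toLinearMap)
    Subtype.val_injective
  { alg := pointAlgebra a ha
    proj := a.toHom.liftOfInjective (quasiCoherentMap (pointAlgebra a ha).val.toLinearMap)
      hinj (toHom_mem_range hM a ha)
    isAlgHom := by
      have h := quasiCoherentMap_isAlgHom (pointAlgebra a ha).val
      refine ⟨fun S x y => hinj S ?_, fun S => hinj S ?_⟩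
      · rw [h.map_mul, Hom.app_liftOfInjective, Hom.app_liftOfInjective,
          Hom.app_liftOfInjective, (toHom_isAlgHom ha).map_mul]
      · rw [h.map_one, Hom.app_liftOfInjective, (toHom_isAlgHom ha).map_one]
    surjective := by
      intro S x
      change S ⊗[K] pointAlgebra a ha at x
      induction x with
      | zero => exact ⟨0, map_zero _⟩
      | add x y hx hy =>
        obtain ⟨⟨m, rfl⟩, ⟨n, rfl⟩⟩ := And.intro hx hy
        exact ⟨m + n, map_add _ _ _⟩
      | tmul s b =>
        -- By definition of the point algebra, `b` is the value at some `m ∈ M(K)`, so `s` times the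
        -- base change of `m` is a preimage of `s ⊗ b`.
        obtain ⟨b, m, rfl⟩ := b
        refine ⟨s • M.map (algInit S) m, hinj S ?_⟩
        rw [Hom.app_liftOfInjective, map_smul, DualElt.toHom_app_map_init, smul_tmul',
          smul_eq_mul, mul_one]
        rfl }

lemma pointQuotient_proj (hM : M.IsReflexive) (a : DualElt M T) (ha : a ∈ SpecElt A T)
    (m : M.obj S) :
    (quasiCoherentMap (pointAlgebra a ha).val.toLinearMap).app S
      ((pointQuotient hM a ha).proj.app S m) = a.toHom.app S m :=
  Hom.app_liftOfInjective _ _ _ _ _ _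

lemma app_map_eq_pointQuotient (hM : M.IsReflexive) (a : DualElt M T) (ha : a ∈ SpecElt A T)
    (k : S ⟶ U) (f : T ⟶ U) (m : M.obj S) :
    a.app U f (M.map k m) =
      descHom k (pointAlgebraVal a ha ≫ f) ((pointQuotient hM a ha).proj.app S m) := by
  rw [a.app_map, ← pointQuotient_proj hM a ha]
  exact descHom_quasiCoherentMap k (pointAlgebraVal a ha) f _

end Field

/-! ### Elements of an algebra as functions on its spectrum. -/

section SpecModel

variable {R : Type u} [CommRing R]

/-- A functor of sets `X` with a natural bijection from `X` onto `Spec A`. -/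
structure SpecModel {M : ModFun.{u, v} R} (A : AlgStr M) (X : CommAlgCat.{u} R ⥤ Type w) where
  pt : ∀ S : CommAlgCat.{u} R, X.obj S → DualElt M S
  pt_map : ∀ {S T : CommAlgCat.{u} R} (f : S ⟶ T) (x : X.obj S),
    pt T (X.map f x) = (dual M).map f (pt S x)
  pt_injective : ∀ S, Function.Injective (pt S)
  pt_mem : ∀ S x, pt S x ∈ SpecElt A S
  exists_pt : ∀ S, ∀ a ∈ SpecElt A S, ∃ x, pt S x = a

variable {M : ModFun.{u, v} R} {A : AlgStr M} {X : CommAlgCat.{u} R ⥤ Type w}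

/-- The elements of `M` as functions on `Spec A`. -/
def SpecModel.evalHom (P : SpecModel A X) : Hom M (functions X) where
  app S :=
    { toFun := fun m => (⟨fun T f x => (P.pt T x).app T (𝟙 T) (M.map f m), fun {T U} f g x => by
        rw [P.pt_map, dual_map_app, M.map_comp, ← DualElt.naturality, Category.comp_id,
          Category.id_comp]⟩ : FunElt X S)
      map_add' := fun m n => by
        apply FunElt.ext
        funext T f x
        change (P.pt T x).app T (𝟙 T) (M.map f (m + n)) = _
        rw [map_add, map_add]
        rfl
      map_smul' := fun s m => by
        apply FunElt.ext
        funext T f x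
        change (P.pt T x).app T (𝟙 T) (M.map f (s • m)) = _
        rw [LinearMap.map_smulₛₗ, map_smul]
        rfl }
  naturality {S T} h m := by
    apply FunElt.ext
    funext U f x
    change (P.pt U x).app U (𝟙 U) (M.map f (M.map h m)) = (P.pt U x).app U (𝟙 U) (M.map (h ≫ f) m)
    rw [M.map_comp]

lemma SpecModel.evalHom_app_app (P : SpecModel A X) {S T : CommAlgCat.{u} R} (m : M.obj S)
    (f : S ⟶ T) (x : X.obj T) :
    FunElt.app (P.evalHom.app S m) T f x = (P.pt T x).app T (𝟙 T) (M.map f m) := rfl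

lemma SpecModel.evalHom_isAlgHom (P : SpecModel A X) :
    IsAlgHom A (functionsAlg X) P.evalHom := by
  refine ⟨fun S a b => ?_, fun S => ?_⟩
  · apply FunElt.ext
    funext T f x
    rw [P.evalHom_app_app, A.map_mul, (P.pt_mem T x T (𝟙 T)).1]
    rfl
  · apply FunElt.ext
    funext T f x
    rw [P.evalHom_app_app, A.map_one, (P.pt_mem T x T (𝟙 T)).2]
    rfl

/-- Under the dictionary between dual elements and morphisms to quasi-coherent modules, base change
of a dual element is composition with the morphism induced by `s`. -/
lemma toHom_map_toDualElt {S T U : CommAlgCat.{u} R} (φ : Hom M (quasiCoherent R T)) (s : T ⟶ U)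
    (m : M.obj S) : (DualElt.toHom ((dual M).map s φ.toDualElt)).app S m =
      (quasiCoherentMap s.hom.toLinearMap).app S (φ.app S m) := by
  rw [DualElt.toHom_app, dual_map_app, φ.toDualElt_app_map, ← descHom_quasiCoherentMap,
    descHom_inl_inr, AlgEquiv.apply_symm_apply]

/-- The morphism of commutative algebras given by the value of a morphism of quasi-coherent
algebras. -/
noncomputable def algTensorMap {B B' : CommAlgCat.{u} R}
    (t : Hom (quasiCoherent R B) (quasiCoherent R B'))
    (ht : IsAlgHom (quasiCoherentAlg R B) (quasiCoherentAlg R B') t) (S : CommAlgCat.{u} R) :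
    algTensor S B ⟶ algTensor S B' :=
  CommAlgCat.ofHom (((algUntensor S B').symm.toAlgHom.comp
    ((AlgHom.ofLinearMap (A := S ⊗[R] B) (B := S ⊗[R] B') (t.app S) (ht.map_one S)
      (ht.map_mul S)).restrictScalars R)).comp (algUntensor S B).toAlgHom)

section

variable {B B' S U : CommAlgCat.{u} R} (t : Hom (quasiCoherent R B) (quasiCoherent R B'))
  (ht : IsAlgHom (quasiCoherentAlg R B) (quasiCoherentAlg R B') t)

lemma algTensorMap_apply (x : algTensor S B) :
    (algTensorMap t ht S).hom x = (algUntensor S B').symm (t.app S (algUntensor S B x)) := rfl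

lemma algInl_algTensorMap : algInl S B ≫ algTensorMap t ht S = algInl S B' := by
  ext s
  change t.app S (s ⊗ₜ[R] 1) = s ⊗ₜ[R] 1
  have h : ∀ C : CommAlgCat.{u} R, (s ⊗ₜ[R] 1 : S ⊗[R] C) = s • (1 : S ⊗[R] C) := fun C => by
    rw [Algebra.TensorProduct.one_def, smul_tmul', smul_eq_mul, mul_one]
  rw [h, h, map_smul]
  exact congrArg (s • ·) (ht.map_one S)

lemma descHom_smul (g : B ⟶ U) (r : U) (z : U ⊗[R] B) :
    descHom (𝟙 U) g (r • z) = r * descHom (𝟙 U) g z := by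
  rw [Algebra.smul_def, map_mul]
  exact congrArg (· * _) (Algebra.TensorProduct.productMap_left_apply _ _ r)

/-- Every `r ⊗ b` is `r` times the base change of `1 ⊗ b ∈ S ⊗ B`, so linearity and naturality of
`t` reduce its value over `U` to its value over `S`. -/
lemma descHom_algTensorMap (h : algTensor S B' ⟶ U) (z : U ⊗[R] B) :
    descHom (𝟙 U) (algInr S B ≫ algTensorMap t ht S ≫ h) z =
      descHom (𝟙 U) (algInr S B' ≫ h) (t.app U z) := by
  induction z with
  | zero => simp
  | add x y hx hy => rw [map_add, map_add, map_add, hx, hy]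
  | tmul r b =>
    have h₁ : (r ⊗ₜ[R] b : U ⊗[R] B) =
        r • (quasiCoherent R B).map (algInl S B' ≫ h) ((1 : S) ⊗ₜ[R] b) := by
      change _ = r • (((algInl S B' ≫ h).hom 1) ⊗ₜ[R] b)
      rw [map_one, smul_tmul', smul_eq_mul, mul_one]
    rw [h₁, LinearMap.map_smul, t.naturality, descHom_smul, descHom_smul, descHom_map,
      descHom_map, Category.comp_id, ← hom_descHom, descHom_inl_inr,
      Algebra.TensorProduct.productMap_apply_tmul, map_one, one_mul]
    rfl

/-- Applied to the projection onto a quotient, this says that a morphism of quotients carries one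
universal point to the other after base change to `S`; hence functions evaluated there give
compatible families. -/
lemma map_algTensorMap_toDualElt (φ : Hom M (quasiCoherent R B)) :
    (dual M).map (algTensorMap t ht S) ((dual M).map (algInr S B) φ.toDualElt) =
      (dual M).map (algInr S B') (φ.comp t).toDualElt := by
  apply DualElt.ext
  funext V h
  ext m
  exact descHom_algTensorMap t ht h (φ.app V m)

end

end SpecModel

/-! ### Pro-quasicoherent algebras are the functions on their spectra. -/

section Quotients

variable {K : Type u} [Field K] {M : ModFun.{u, v} K} {A : AlgStr M}

lemma QCQuotient.exists_proj_eq (Q : QCQuotient A) (z : Q.alg) :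
    ∃ m : M.obj (CommAlgCat.of K K), Q.proj.app _ m = (1 : K) ⊗ₜ[K] z :=
  Q.surjective _ _

/-- The quasi-coherent algebra quotients of a functor of commutative algebras are commutative. -/
abbrev QCQuotient.commRing (Q : QCQuotient A) (hA : A.IsComm) : CommRing Q.alg :=
  { Q.ring with
    mul_comm := fun x y => by
      obtain ⟨m, hm⟩ := Q.exists_proj_eq x
      obtain ⟨n, hn⟩ := Q.exists_proj_eq y
      have h := congrArg (Q.proj.app _) (hA _ m n)
      rw [Q.isAlgHom.map_mul, Q.isAlgHom.map_mul, hm, hn] at h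
      have h' : ((1 : K) ⊗ₜ[K] x) * ((1 : K) ⊗ₜ[K] y) =
        ((1 : K) ⊗ₜ[K] y) * ((1 : K) ⊗ₜ[K] x) := h
      simpa using congrArg (TensorProduct.lid K Q.alg) h' }

/-- A quasi-coherent algebra quotient of a functor of commutative algebras, as a commutative
algebra. -/
abbrev QCQuotient.commAlg (Q : QCQuotient A) (hA : A.IsComm) : CommAlgCat.{u} K :=
  @CommAlgCat.of K _ Q.alg (Q.commRing hA) Q.algebra

/-- The universal point of a quasi-coherent algebra quotient. -/
noncomputable def QCQuotient.point (Q : QCQuotient A) (hA : A.IsComm) : DualElt M (Q.commAlg hA) :=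
  Hom.toDualElt (T := Q.commAlg hA) Q.proj

lemma QCQuotient.point_mem (Q : QCQuotient A) (hA : A.IsComm) :
    Q.point hA ∈ SpecElt A (Q.commAlg hA) :=
  toDualElt_mem (T := Q.commAlg hA) Q.isAlgHom

lemma QCQuotient.point_app_map (Q : QCQuotient A) (hA : A.IsComm) {S U : CommAlgCat.{u} K}
    (k : S ⟶ U) (f : Q.commAlg hA ⟶ U) (m : M.obj S) :
    (Q.point hA).app U f (M.map k m) = descHom k f (Q.proj.app S m) :=
  Hom.toDualElt_app_map (T := Q.commAlg hA) Q.proj k f m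

/-- The inclusion of the algebra of values at a point. -/
noncomputable def pointQuotientVal (hM : M.IsReflexive) (hA : A.IsComm) {T : CommAlgCat.{u} K}
    (a : DualElt M T) (ha : a ∈ SpecElt A T) : (pointQuotient hM a ha).commAlg hA ⟶ T :=
  pointAlgebraVal a ha

lemma app_map_eq_descHom (hM : M.IsReflexive) (hA : A.IsComm) {S T U : CommAlgCat.{u} K}
    (a : DualElt M T) (ha : a ∈ SpecElt A T) (k : S ⟶ U) (f : T ⟶ U) (m : M.obj S) :
    a.app U f (M.map k m) =
      descHom k (pointQuotientVal hM hA a ha ≫ f) ((pointQuotient hM a ha).proj.app S m) :=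
  app_map_eq_pointQuotient hM a ha k f m

/-- Each point is a base change of the universal point of the quotient through which it factors: the
spectrum is the union of the spectra of the quasi-coherent quotients. -/
lemma map_pointQuotientVal_point (hM : M.IsReflexive) (hA : A.IsComm) {T : CommAlgCat.{u} K}
    (a : DualElt M T) (ha : a ∈ SpecElt A T) :
    (dual M).map (pointQuotientVal hM hA a ha) ((pointQuotient hM a ha).point hA) = a := by
  apply DualElt.ext
  funext V h
  ext m
  have := app_map_eq_descHom hM hA a ha (𝟙 V) h m
  rw [M.map_id] at this
  exact this.symm

/-- The family `x` of elements of the values at `S` of the quasi-coherent algebra quotients is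
compatible with the morphisms of quotients. -/
def IsCompatibleFamily (A : AlgStr M) (S : CommAlgCat.{u} K)
    (x : ∀ Q : QCQuotient A, (quasiCoherent K Q.alg).obj S) : Prop :=
  ∀ (Q Q' : QCQuotient A) (t : Hom (quasiCoherent K Q.alg) (quasiCoherent K Q'.alg)),
    IsAlgHom (quasiCoherentAlg K Q.alg) (quasiCoherentAlg K Q'.alg) t →
    Q.proj.comp t = Q'.proj → t.app S (x Q) = x Q'

/-- If a point factors through the quotient `Q`, then the value of a compatible family at this point
can be computed in `Q`. -/
lemma IsCompatibleFamily.descHom_eq (hM : M.IsReflexive) (hA : A.IsComm) {S T : CommAlgCat.{u} K}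
    {x : ∀ Q : QCQuotient A, (quasiCoherent K Q.alg).obj S} (hx : IsCompatibleFamily A S x)
    (Q : QCQuotient A) (s : Q.commAlg hA ⟶ T) (a : DualElt M T) (ha : a ∈ SpecElt A T)
    (h : a = (dual M).map s (Q.point hA)) (k : S ⟶ T) :
    descHom k (pointQuotientVal hM hA a ha) (x (pointQuotient hM a ha)) =
      descHom (T := Q.commAlg hA) k s (x Q) := by
  -- Elements of `Q` lift to `M(K)`, so `s` takes values in the point algebra of `a` and corestricts
  -- to a morphism of quotients, to which compatibility of the family applies.
  have hs : ∀ z : Q.commAlg hA, s.hom z ∈ pointAlgebra a ha := by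
    intro z
    obtain ⟨m, hm⟩ := Q.exists_proj_eq z
    refine ⟨m, ?_⟩
    change a.app T (𝟙 T) (M.map (algInit T) m) = _
    rw [h, dual_map_app, Category.comp_id, Q.point_app_map, hm]
    simp
  let _ := Q.commRing hA
  let t₀ : Q.commAlg hA ⟶ CommAlgCat.of K (pointAlgebra a ha) :=
    CommAlgCat.ofHom (s.hom.codRestrict (pointAlgebra a ha) hs)
  have hval : t₀ ≫ pointAlgebraVal a ha = s := rfl
  have hcomp (U : CommAlgCat.{u} K) (y : U ⊗[K] (Q.commAlg hA)) :
      (quasiCoherentMap (pointAlgebra a ha).val.toLinearMap).app U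
        ((quasiCoherentMap t₀.hom.toLinearMap).app U y) =
      (quasiCoherentMap s.hom.toLinearMap).app U y := by
    induction y with
    | zero => simp
    | add y z hy hz => simp only [map_add, hy, hz]
    | tmul u z => rfl
  -- Both projections are compared inside the quasi-coherent algebra of `T`, where each becomes the
  -- morphism attached to `a`.
  have ht : Q.proj.comp (quasiCoherentMap t₀.hom.toLinearMap) = (pointQuotient hM a ha).proj := by
    apply ModFun.Hom.ext
    funext U
    ext m
    apply quasiCoherentMap_injective (l := (pointAlgebra a ha).val.toLinearMap)
      Subtype.val_injective U
    refine (hcomp U _).trans ((pointQuotient_proj hM a ha m).trans ?_).symm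
    subst h
    exact toHom_map_toDualElt (T := Q.commAlg hA) Q.proj s m
  rw [← hx Q (pointQuotient hM a ha) _ (quasiCoherentMap_isAlgHom t₀.hom) ht]
  exact descHom_quasiCoherentMap (V := Q.commAlg hA) k t₀ (pointAlgebraVal a ha) (x Q)

variable {X : CommAlgCat.{u} K ⥤ Type w} (P : SpecModel A X)

lemma SpecModel.exists_point (hA : A.IsComm) (Q : QCQuotient A) :
    ∃ y : X.obj (Q.commAlg hA), P.pt _ y = Q.point hA :=
  P.exists_pt _ _ (Q.point_mem hA)

/-- The link between functions and families: projecting to a quotient is evaluating at its universal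
point, after base change. -/
lemma SpecModel.evalHom_point (hA : A.IsComm) (Q : QCQuotient A) (y : X.obj (Q.commAlg hA))
    (hy : P.pt _ y = Q.point hA) {S : CommAlgCat.{u} K} (m : M.obj S) :
    FunElt.app (P.evalHom.app S m) (algTensor S (Q.commAlg hA)) (algInl _ _)
      (X.map (algInr _ _) y) = (algUntensor _ _).symm (Q.proj.app S m) := by
  rw [P.evalHom_app_app, P.pt_map, hy, dual_map_app, Category.comp_id, Q.point_app_map,
    descHom_inl_inr]

/-- A compatible family defines a function: at a point, take the member of the family in the
quotient attached to that point and map it to the coefficients. By hypothesis this function comes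
from a unique element of `M(S)`. -/
lemma SpecModel.isProQuasicoherent (hM : M.IsReflexive) (hA : A.IsComm)
    (hP : P.evalHom.Bijective) : A.IsProQuasicoherent := by
  intro S x hx
  let F : FunElt X S :=
    ⟨fun T f y => descHom f (pointQuotientVal hM hA (P.pt T y) (P.pt_mem T y))
        (x (pointQuotient hM (P.pt T y) (P.pt_mem T y))), fun {T U} f g y => by
      -- The quotient attached to a base change of `y` may be smaller than that of `y`;
      -- `IsCompatibleFamily.descHom_eq` makes both give the same value.
      refine Eq.trans ?_ (hom_descHom _ _ _ _).symm
      refine IsCompatibleFamily.descHom_eq hM hA hx (pointQuotient hM (P.pt T y) (P.pt_mem T y))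
        (pointQuotientVal hM hA (P.pt T y) (P.pt_mem T y) ≫ g) _ _ ?_ _
      rw [P.pt_map, (dual M).map_comp]
      exact congrArg _ (map_pointQuotientVal_point hM hA (P.pt T y) (P.pt_mem T y)).symm⟩
  obtain ⟨m, hm⟩ := (hP S).2 F
  refine ⟨m, fun Q => ?_, fun m' hm' => (hP S).1 ?_⟩
  · obtain ⟨y, hy⟩ := P.exists_point hA Q
    apply (algUntensor S (Q.commAlg hA)).symm.injective
    rw [← P.evalHom_point hA Q y hy, hm]
    refine (IsCompatibleFamily.descHom_eq hM hA hx Q (algInr S (Q.commAlg hA)) _ _ ?_ _).trans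
      (descHom_inl_inr _)
    rw [P.pt_map, hy]
  · rw [hm]
    apply FunElt.ext
    funext T f y
    rw [P.evalHom_app_app, app_map_eq_descHom hM hA _ (P.pt_mem T y), hm', Category.comp_id]

/-- The values of a function at the universal points of the quotients form a compatible family,
which the limit property turns into an element of `M(S)`. As each point is a base change of a
universal one, the element induces the given function. -/
lemma SpecModel.evalHom_bijective (hM : M.IsReflexive) (hA : A.IsComm)
    (hP : A.IsProQuasicoherent) : P.evalHom.Bijective := by
  intro S
  choose y hy using P.exists_point hA
  refine ⟨fun m n hmn => ?_, fun F => ?_⟩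
  · refine (hP S (fun Q => Q.proj.app S m) ?_).unique (fun _ => rfl) fun Q => ?_
    · rintro Q Q' t - h
      exact congrArg (fun φ => ModFun.Hom.app φ S m) h
    · apply (algUntensor S (Q.commAlg hA)).symm.injective
      rw [← P.evalHom_point hA Q _ (hy Q), ← P.evalHom_point hA Q _ (hy Q), hmn]
  · change FunElt X S at F
    obtain ⟨m, hm, -⟩ := hP S (fun Q => algUntensor S (Q.commAlg hA)
        (F.app (algTensor S (Q.commAlg hA)) (algInl _ _) (X.map (algInr _ _) (y Q)))) (by
      intro Q Q' t ht h
      have hF := F.naturality (algInl _ _)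
        (algTensorMap (B := Q.commAlg hA) (B' := Q'.commAlg hA) t ht S) (X.map (algInr _ _) (y Q))
      have hy' : X.map (algTensorMap (B := Q.commAlg hA) (B' := Q'.commAlg hA) t ht S)
          (X.map (algInr _ _) (y Q)) = X.map (algInr _ _) (y Q') := by
        apply P.pt_injective
        rw [P.pt_map, P.pt_map, P.pt_map, hy, hy]
        refine (map_algTensorMap_toDualElt (B := Q.commAlg hA) (B' := Q'.commAlg hA)
          t ht Q.proj).trans ?_
        exact congrArg (fun φ => (dual M).map (algInr S (Q'.commAlg hA))
          (ModFun.Hom.toDualElt (T := Q'.commAlg hA) φ)) h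
      rw [hy', algInl_algTensorMap, algTensorMap_apply] at hF
      exact ((AlgEquiv.eq_symm_apply _).1 hF).symm)
    refine ⟨m, ?_⟩
    apply FunElt.ext
    funext T f x
    rw [P.evalHom_app_app, app_map_eq_descHom hM hA _ (P.pt_mem T x), hm,
      Category.comp_id]
    -- The value of `F` at `x` is compared with its value at the universal point along `S ⊗ B → T`,
    -- where `B` is the point algebra of `x`.
    have hF := F.naturality (algInl S _)
      (algDesc f (pointQuotientVal hM hA (P.pt T x) (P.pt_mem T x)))
      (X.map (algInr _ _) (y (pointQuotient hM (P.pt T x) (P.pt_mem T x))))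
    have hy' : X.map (algDesc f (pointQuotientVal hM hA (P.pt T x) (P.pt_mem T x)))
        (X.map (algInr _ _) (y (pointQuotient hM (P.pt T x) (P.pt_mem T x)))) = x := by
      apply P.pt_injective
      rw [P.pt_map, P.pt_map, hy, ← (dual M).map_comp, algInr_desc]
      exact map_pointQuotientVal_point hM hA (P.pt T x) (P.pt_mem T x)
    rw [hy', algInl_desc] at hF
    exact hF.symm

end Quotients

/-! ### The convolution algebra on the dual of the functions on a functor of monoids. -/

section Convolution

variable {R : Type u} [CommRing R] (G : CommAlgCat.{u} R ⥤ MonCat.{u})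

/-- The product of two points of a functor of monoids. -/
def pmul (S : CommAlgCat.{u} R) (g h : (underlying G).obj S) : (underlying G).obj S :=
  (show G.obj S from g) * (show G.obj S from h)

/-- The unit point of a functor of monoids. -/
def pone (S : CommAlgCat.{u} R) : (underlying G).obj S := (1 : G.obj S)

variable {S T U : CommAlgCat.{u} R}

variable {G} in
lemma map_pmul (f : S ⟶ T) (g h : (underlying G).obj S) :
    (underlying G).map f (pmul G S g h) =
      pmul G T ((underlying G).map f g) ((underlying G).map f h) :=
  MonoidHom.map_mul (G.map f).hom (show G.obj S from g) (show G.obj S from h)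

variable {G} in
lemma map_pone (f : S ⟶ T) : (underlying G).map f (pone G S) = pone G T :=
  MonoidHom.map_one (G.map f).hom

variable {G} in
lemma pmul_assoc (a b c : (underlying G).obj S) :
    pmul G S (pmul G S a b) c = pmul G S a (pmul G S b c) :=
  mul_assoc (G := G.obj S) a b c

variable {G} in
lemma pone_pmul (a : (underlying G).obj S) : pmul G S (pone G S) a = a := one_mul (M := G.obj S) a

variable {G} in
lemma pmul_pone (a : (underlying G).obj S) : pmul G S a (pone G S) = a := mul_one (M := G.obj S) a

variable {G}

lemma points_map_id {X : CommAlgCat.{u} R ⥤ Type w} (x : X.obj S) : X.map (𝟙 S) x = x := by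
  simp

lemma points_map_comp {X : CommAlgCat.{u} R ⥤ Type w} (f : S ⟶ T) (g : T ⟶ U) (x : X.obj S) :
    X.map (f ≫ g) x = X.map g (X.map f x) := by
  simp

namespace FunElt

/-- The function `h ↦ F(gh)`. -/
def translate (F : FunElt (underlying G) S) (f : S ⟶ T) (g : (underlying G).obj T) :
    FunElt (underlying G) T :=
  ⟨fun U k h => F.app U (f ≫ k) (pmul G U ((underlying G).map k g) h), fun {U V} k l h => by
    rw [points_map_comp, ← map_pmul, ← Category.assoc, F.naturality]⟩

lemma translate_app (F : FunElt (underlying G) S) (f : S ⟶ T) (g : (underlying G).obj T)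
    (k : T ⟶ U) (h : (underlying G).obj U) :
    (F.translate f g).app U k h = F.app U (f ≫ k) (pmul G U ((underlying G).map k g) h) := rfl

lemma map_translate (F : FunElt (underlying G) S) (f : S ⟶ T) (g : (underlying G).obj T)
    (k : T ⟶ U) : (functions (underlying G)).map k (F.translate f g) =
      F.translate (f ≫ k) ((underlying G).map k g) := by
  apply FunElt.ext
  funext V l h
  change F.app V (f ≫ k ≫ l) (pmul G V ((underlying G).map (k ≫ l) g) h) =
    F.app V ((f ≫ k) ≫ l) (pmul G V ((underlying G).map l ((underlying G).map k g)) h)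
  rw [points_map_comp, Category.assoc]

lemma translate_map (F : FunElt (underlying G) S) (f : S ⟶ T) (k : T ⟶ U)
    (g : (underlying G).obj U) :
    translate ((functions (underlying G)).map f F) k g = F.translate (f ≫ k) g := by
  apply FunElt.ext
  funext V l h
  change F.app V (f ≫ k ≫ l) _ = F.app V ((f ≫ k) ≫ l) _
  rw [Category.assoc]

/-- The function `g ↦ b(h ↦ F(gh))`. -/
def convolve (b : DualElt (functions (underlying G)) S) (F : FunElt (underlying G) S) :
    FunElt (underlying G) S :=
  ⟨fun T f g => b.app T f (F.translate f g), fun {T U} f k g => by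
    rw [← b.naturality, map_translate]⟩

lemma convolve_app (b : DualElt (functions (underlying G)) S) (F : FunElt (underlying G) S)
    (f : S ⟶ T) (g : (underlying G).obj T) :
    (convolve b F).app T f g = b.app T f (F.translate f g) := rfl

lemma map_convolve (b : DualElt (functions (underlying G)) S) (F : FunElt (underlying G) S)
    (f : S ⟶ T) : (functions (underlying G)).map f (convolve b F) =
      convolve ((dual (functions (underlying G))).map f b)
        ((functions (underlying G)).map f F) := by
  apply FunElt.ext
  funext U k g
  change b.app U (f ≫ k) (F.translate (f ≫ k) g) =
    b.app U (f ≫ k) (translate ((functions (underlying G)).map f F) k g)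
  rw [translate_map]

/-- Convolution acts on the right variable and translation on the left one; they commute because the
product of `G` is associative. -/
lemma convolve_translate (b : DualElt (functions (underlying G)) S) (F : FunElt (underlying G) S)
    (f : S ⟶ T) (g : (underlying G).obj T) :
    convolve ((dual (functions (underlying G))).map f b) (F.translate f g) =
      (convolve b F).translate f g := by
  apply FunElt.ext
  funext U k h
  change b.app U (f ≫ k) ((F.translate f g).translate k h) =
    b.app U (f ≫ k) (F.translate (f ≫ k) (pmul G U ((underlying G).map k g) h))
  congr 1
  apply FunElt.ext
  funext V l h'
  change F.app V (f ≫ k ≫ l) (pmul G V ((underlying G).map (k ≫ l) g)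
      (pmul G V ((underlying G).map l h) h')) =
    F.app V ((f ≫ k) ≫ l) (pmul G V ((underlying G).map l
      (pmul G U ((underlying G).map k g) h)) h')
  rw [map_pmul, pmul_assoc, points_map_comp, Category.assoc]

lemma convolve_smul_left (s : S) (b : DualElt (functions (underlying G)) S)
    (F : FunElt (underlying G) S) : convolve (s • b) F = s • convolve b F := rfl

lemma convolve_add_right (b : DualElt (functions (underlying G)) S)
    (F F' : FunElt (underlying G) S) : convolve b (F + F') = convolve b F + convolve b F' := by
  apply FunElt.ext
  funext T f g
  exact map_add (b.app T f) (F.translate f g) (F'.translate f g)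

lemma convolve_smul_right (s : S) (b : DualElt (functions (underlying G)) S)
    (F : FunElt (underlying G) S) : convolve b (s • F) = s • convolve b F := by
  apply FunElt.ext
  funext T f g
  refine Eq.trans ?_ (map_smul (b.app T f) (f.hom s) (F.translate f g))
  refine congrArg (b.app T f) (FunElt.ext ?_)
  funext U k h
  change (f ≫ k).hom s * _ = k.hom (f.hom s) * _
  rfl

lemma convolve_evalPoint (g : (underlying G).obj S) (F : FunElt (underlying G) S) (f : S ⟶ T)
    (h : (underlying G).obj T) :
    (convolve (evalPoint (underlying G) S g) F).app T f h =
      F.app T f (pmul G T h ((underlying G).map f g)) := by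
  change F.app T (f ≫ 𝟙 T) (pmul G T ((underlying G).map (𝟙 T) h) ((underlying G).map f g)) = _
  rw [Category.comp_id, points_map_id]

end FunElt

/-- The product `(ab)(F) = a(g ↦ b(h ↦ F(gh)))` on the dual of the functions on a functor of
monoids. -/
def conv (a b : DualElt (functions (underlying G)) S) : DualElt (functions (underlying G)) S where
  app T f :=
    { toFun := fun F : FunElt (underlying G) T =>
        a.app T f (FunElt.convolve ((dual (functions (underlying G))).map f b) F)
      map_add' := fun F F' => by
        rw [FunElt.convolve_add_right]
        exact map_add (a.app T f) _ _
      map_smul' := fun s F => by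
        rw [FunElt.convolve_smul_right]
        exact map_smul (a.app T f) s _ }
  naturality {T U} f k F := by
    change a.app U (f ≫ k) (FunElt.convolve ((dual (functions (underlying G))).map (f ≫ k) b)
      ((functions (underlying G)).map k F)) = k.hom (a.app T f _)
    rw [← a.naturality, FunElt.map_convolve, ← (dual (functions (underlying G))).map_comp]

lemma conv_app (a b : DualElt (functions (underlying G)) S) (f : S ⟶ T)
    (F : FunElt (underlying G) T) : (conv a b).app T f F =
      a.app T f (FunElt.convolve ((dual (functions (underlying G))).map f b) F) := rfl

/-- The convolution product thus becomes composition of operators on functions, from which its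
associativity follows. -/
lemma convolve_conv (a b : DualElt (functions (underlying G)) S) (F : FunElt (underlying G) S) :
    FunElt.convolve (conv a b) F = FunElt.convolve a (FunElt.convolve b F) := by
  apply FunElt.ext
  funext T f g
  rw [FunElt.convolve_app, conv_app, FunElt.convolve_app, FunElt.convolve_translate]

lemma map_conv (a b : DualElt (functions (underlying G)) S) (f : S ⟶ T) :
    (dual (functions (underlying G))).map f (conv a b) =
      conv ((dual (functions (underlying G))).map f a)
        ((dual (functions (underlying G))).map f b) := by
  apply DualElt.ext
  funext U k
  ext F
  change a.app U (f ≫ k) (FunElt.convolve ((dual (functions (underlying G))).map (f ≫ k) b) F) =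
    a.app U (f ≫ k) (FunElt.convolve ((dual (functions (underlying G))).map k
      ((dual (functions (underlying G))).map f b)) F)
  rw [← (dual (functions (underlying G))).map_comp]

lemma map_evalPoint {X : CommAlgCat.{u} R ⥤ Type w} (f : S ⟶ T) (x : X.obj S) :
    (dual (functions X)).map f (evalPoint X S x) = evalPoint X T (X.map f x) := by
  apply DualElt.ext
  funext U k
  ext F
  change FunElt.app F U (𝟙 U) (X.map (f ≫ k) x) = FunElt.app F U (𝟙 U) (X.map k (X.map f x))
  rw [points_map_comp]

variable (G) in
/-- The algebra structure on the dual of the functor of functions on a functor of monoids. -/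
def convAlg : AlgStr (dual (functions (underlying G))) where
  mul S := LinearMap.mk₂ S (conv (S := S)) (fun _ _ _ => rfl) (fun _ _ _ => rfl)
    (fun a b b' => by
      apply DualElt.ext
      funext T f
      ext F
      exact map_add (a.app T f)
        (FunElt.convolve ((dual (functions (underlying G))).map f b) F)
        (FunElt.convolve ((dual (functions (underlying G))).map f b') F))
    (fun s a b => by
      apply DualElt.ext
      funext T f
      ext F
      rw [DualElt.smul_app, LinearMap.smul_apply, conv_app, conv_app, ← map_smul,
        ← FunElt.convolve_smul_left, LinearMap.map_smulₛₗ]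
      rfl)
  one S := evalPoint (underlying G) S (pone G S)
  mul_assoc S a b c := by
    apply DualElt.ext
    funext T f
    ext F
    change (conv (conv a b) c).app T f F = (conv a (conv b c)).app T f F
    rw [conv_app, conv_app, conv_app, map_conv, convolve_conv]
  one_mul S a := by
    apply DualElt.ext
    funext T f
    ext F
    change DualElt.app a T (f ≫ 𝟙 T)
      (FunElt.translate F (𝟙 T) ((underlying G).map f (pone G S))) = DualElt.app a T f F
    rw [Category.comp_id]
    congr 1
    apply FunElt.ext
    funext U k h
    rw [FunElt.translate_app, map_pone, map_pone, pone_pmul, Category.id_comp]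
  mul_one S a := by
    apply DualElt.ext
    funext T f
    ext F
    change (conv a (evalPoint (underlying G) S (pone G S))).app T f F = DualElt.app a T f F
    rw [conv_app, map_evalPoint, map_pone]
    congr 1
    apply FunElt.ext
    funext U k h
    rw [FunElt.convolve_evalPoint, map_pone, pmul_pone]
  map_mul f a b := map_conv a b f
  map_one f := by rw [map_evalPoint, map_pone]

lemma evalPoint_pmul (g h : (underlying G).obj S) :
    evalPoint (underlying G) S (pmul G S g h) =
      (convAlg G).mul S (evalPoint (underlying G) S g) (evalPoint (underlying G) S h) := by
  apply DualElt.ext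
  funext T f
  ext F
  change FunElt.app F T (𝟙 T) ((underlying G).map f (pmul G S g h)) =
    (conv (evalPoint (underlying G) S g) (evalPoint (underlying G) S h)).app T f F
  rw [conv_app, map_evalPoint]
  change _ = FunElt.app (FunElt.convolve (evalPoint (underlying G) T ((underlying G).map f h)) F)
    T (𝟙 T) ((underlying G).map f g)
  rw [FunElt.convolve_evalPoint, points_map_id, map_pmul]

end Convolution

/-! ### Tensor products of quasi-coherent algebras. -/

section TensorQuasiCoherent

variable {R : Type u} [CommRing R]

/-- The canonical morphism from the quasi-coherent module of `V ⊗ W` to the tensor product of the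
quasi-coherent modules of `V` and of `W`. -/
noncomputable def quasiCoherentDistrib (V W : Type u) [AddCommGroup V] [Module R V]
    [AddCommGroup W] [Module R W] :
    Hom (quasiCoherent R (V ⊗[R] W)) (ModFun.tensor (quasiCoherent R V) (quasiCoherent R W)) where
  app S := (AlgebraTensorModule.distribBaseChange R S V W).toLinearMap
  naturality {S T} f x := by
    change S ⊗[R] (V ⊗[R] W) at x
    induction x with
    | zero => simp only [map_zero]
    | add x y hx hy => rw [map_add, map_add, hx, hy, map_add, map_add]
    | tmul s z =>
      induction z with
      | zero => rw [tmul_zero]; simp only [map_zero]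
      | add x y hx hy => rw [tmul_add, map_add, map_add, hx, hy, map_add, map_add]
      | tmul v w =>
        change (f.hom s ⊗ₜ[R] v) ⊗ₜ[T] ((1 : T) ⊗ₜ[R] w) =
          (f.hom s ⊗ₜ[R] v) ⊗ₜ[T] (f.hom (1 : S) ⊗ₜ[R] w)
        rw [map_one]

lemma quasiCoherentDistrib_isAlgHom (V W : Type u) [Ring V] [Algebra R V] [Ring W] [Algebra R W] :
    IsAlgHom (quasiCoherentAlg R (V ⊗[R] W))
      ((quasiCoherentAlg R V).tensor (quasiCoherentAlg R W)) (quasiCoherentDistrib V W) := by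
  refine ⟨fun S x y => ?_, fun S => rfl⟩
  have h : (LinearMap.mul S (S ⊗[R] (V ⊗[R] W))).compr₂ ((quasiCoherentDistrib V W).app S) =
      (((quasiCoherentAlg R V).tensor (quasiCoherentAlg R W)).mul S).compl₁₂
        ((quasiCoherentDistrib V W).app S) ((quasiCoherentDistrib V W).app S) := by
    -- Both sides are `S`-bilinear, so it is enough to compare them on elements `1 ⊗ (v ⊗ w)`.
    ext v w v' w'
    change (quasiCoherentDistrib V W).app S
        (((1 : S) ⊗ₜ[R] (v ⊗ₜ[R] w)) * ((1 : S) ⊗ₜ[R] (v' ⊗ₜ[R] w'))) =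
      (((1 : S) ⊗ₜ[R] v) * ((1 : S) ⊗ₜ[R] v')) ⊗ₜ[S] (((1 : S) ⊗ₜ[R] w) * ((1 : S) ⊗ₜ[R] w'))
    simp only [Algebra.TensorProduct.tmul_mul_tmul, mul_one]
    rfl
  exact congrArg (fun l => l x y) h

variable {T B B' : CommAlgCat.{u} R}

/-- The reassociation `T ⊗ (B ⊗ B') → (T ⊗ B) ⊗ B'`. -/
noncomputable def algAssoc (T B B' : CommAlgCat.{u} R) :
    algTensor T (algTensor B B') ⟶ algTensor (algTensor T B) B' :=
  algDesc (algInl T B ≫ algInl _ B') (algDesc (algInr T B ≫ algInl _ B') (algInr _ B'))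

/-- Pairing with `a ⊗ b` is computed one variable at a time, first `b` with coefficients in `T ⊗ B`,
then `a`. This is the shape of the convolution product, with which it is to be compared. -/
lemma pairing_quasiCoherentDistrib (a : DualElt (quasiCoherent R B) T)
    (b : DualElt (quasiCoherent R B') T) (e : T ⊗[R] (algTensor B B')) :
    pairing (quasiCoherent R B) (quasiCoherent R B') T
      ((quasiCoherentDistrib B B').app T
        ((quasiCoherentMap (algUntensor B B').toLinearMap).app T e))
      ((a : (dual (quasiCoherent R B)).obj T) ⊗ₜ[T] (b : (dual (quasiCoherent R B')).obj T)) =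
    a.app T (𝟙 T) (algUntensor T B (b.app (algTensor T B) (algInl T B)
      (algUntensor _ B' ((algAssoc T B B').hom ((algUntensor T _).symm e))))) := by
  induction e with
  | zero => simp only [map_zero, LinearMap.zero_apply]
  | add x y hx hy => simp only [map_add, LinearMap.add_apply, hx, hy]
  | tmul t z =>
    obtain ⟨z, rfl⟩ := (algUntensor B B').symm.surjective z
    induction z with
    | zero =>
      simp only [map_zero, tmul_zero, LinearMap.zero_apply]
    | add x y hx hy => simp only [map_add, tmul_add, LinearMap.add_apply, hx, hy]
    | tmul x x' =>
      have h₁ : algUntensor _ B' ((algAssoc T B B').hom ((algUntensor T _).symm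
          (t ⊗ₜ[R] ((algUntensor B B').symm (x ⊗ₜ[R] x'))))) =
          ((algUntensor T B).symm (t ⊗ₜ[R] x)) •
            (quasiCoherent R B').map (algInl T B) ((1 : T) ⊗ₜ[R] x') := by
        rw [algAssoc, algDesc_apply, AlgEquiv.apply_symm_apply,
          Algebra.TensorProduct.productMap_apply_tmul, algDesc_apply, AlgEquiv.apply_symm_apply,
          Algebra.TensorProduct.productMap_apply_tmul, map_mul, map_mul]
        change ((t ⊗ₜ[R] (1 : B) : T ⊗[R] B) ⊗ₜ[R] (1 : B') : (T ⊗[R] B) ⊗[R] B') *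
          ((((1 : T) ⊗ₜ[R] x : T ⊗[R] B) ⊗ₜ[R] (1 : B')) *
            ((1 : T ⊗[R] B) ⊗ₜ[R] x')) =
          (t ⊗ₜ[R] x : T ⊗[R] B) • (((1 : T) ⊗ₜ[R] (1 : B) : T ⊗[R] B) ⊗ₜ[R] x')
        simp only [Algebra.TensorProduct.tmul_mul_tmul, one_mul, mul_one, smul_tmul', smul_eq_mul]
      have h₂ : (quasiCoherentDistrib B B').app T ((quasiCoherentMap
          (algUntensor B B').toLinearMap).app T (t ⊗ₜ[R] ((algUntensor B B').symm (x ⊗ₜ[R] x')))) =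
          (t ⊗ₜ[R] x) ⊗ₜ[T] ((1 : T) ⊗ₜ[R] x') := rfl
      rw [h₁, h₂, pairing_tmul, map_smul]
      have h₃ := b.naturality (𝟙 T) (algInl T B) ((1 : T) ⊗ₜ[R] x')
      rw [Category.id_comp] at h₃
      rw [h₃]
      generalize b.app T (𝟙 T) ((1 : T) ⊗ₜ[R] x') = c
      have h₄ : algUntensor T B ((algUntensor T B).symm (t ⊗ₜ[R] x) • (algInl T B).hom c) =
          c • (t ⊗ₜ[R] x) := by
        change (t ⊗ₜ[R] x : T ⊗[R] B) * (c ⊗ₜ[R] (1 : B)) = _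
        rw [Algebra.TensorProduct.tmul_mul_tmul, mul_one, smul_tmul', smul_eq_mul, mul_comm]
      rw [h₄, map_smul, smul_eq_mul, mul_comm]

end TensorQuasiCoherent

/-! ### The bialgebra of functions on an affine functor of monoids. -/

section FunctionBialgebra

variable {K : Type u} [Field K] {G : CommAlgCat.{u} K ⥤ MonCat.{u}} {M : ModFun.{u, v} K}
  {A : AlgStr M}

/-- A form on `M` that factors through `Q` is, as a form on functions, evaluation at the universal
point of `Q` followed by the form on `Q`, since projection to `Q` is that evaluation. -/
lemma dualMap_proj_eq (P : SpecModel A (underlying G)) (hP : P.evalHom.Bijective) (hA : A.IsComm)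
    (Q : QCQuotient A) (y : (underlying G).obj (Q.commAlg hA)) (hy : P.pt _ y = Q.point hA)
    {T : CommAlgCat.{u} K} (a : DualElt (quasiCoherent K Q.alg) T) :
    ∃ α : DualElt (functions (underlying G)) T,
      (dualMap P.evalHom).app T α = (dualMap Q.proj).app T a ∧
      ∀ (U) (f : T ⟶ U) (F : FunElt (underlying G) U), α.app U f F =
        a.app U f (algUntensor U (Q.commAlg hA) (F.app (algTensor U (Q.commAlg hA)) (algInl _ _)
          ((underlying G).map (algInr _ _) y))) := by
  obtain ⟨α, hα⟩ := (dualMap_bijective _ hP T).2 ((dualMap Q.proj).app T a)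
  refine ⟨α, hα, fun U f F => ?_⟩
  obtain ⟨n, rfl⟩ := (hP U).2 F
  rw [P.evalHom_point hA Q y hy]
  exact congrArg (fun z : DualElt M T => z.app U f n) hα

/-- The comultiplication of the functions on a functor of monoids is a morphism of algebras. -/
lemma comulHom_isAlgHomToTilde (P : SpecModel A (underlying G)) (hP : P.evalHom.Bijective)
    (hA : A.IsComm) (D : AlgStr (dual M)) (hD : IsAlgHom (convAlg G) D (dualMap P.evalHom)) :
    IsAlgHomToTilde A A (comulHom D) := by
  intro Q Q'
  obtain ⟨y, hy⟩ := P.exists_point hA Q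
  obtain ⟨y', hy'⟩ := P.exists_point hA Q'
  let B := Q.commAlg hA
  let B' := Q'.commAlg hA
  -- The product of the two universal points. Evaluation at `z` is the required morphism to `𝓑 ⊗
  -- 𝓑'`, multiplicative because `z` is a point.
  let z : (underlying G).obj (algTensor B B') := pmul G _
    ((underlying G).map (algInl B B') y) ((underlying G).map (algInr B B') y')
  refine ⟨((P.pt _ z).toHom.comp (quasiCoherentMap (algUntensor B B').toLinearMap)).comp
    (quasiCoherentDistrib B B'), ?_, ?_⟩
  · exact ((toHom_isAlgHom (P.pt_mem _ z)).comp
      (quasiCoherentMap_isAlgHom (algUntensor B B').toAlgHom)).comp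
        (quasiCoherentDistrib_isAlgHom B B')
  · apply ModFun.Hom.ext
    funext S
    refine LinearMap.ext fun m => ?_
    apply DualElt.ext
    funext T f
    refine TensorProduct.ext' fun a b => ?_
    change pairing (quasiCoherent K B) (quasiCoherent K B') T
      ((ModFun.tensor (quasiCoherent K B) (quasiCoherent K B')).map f
        ((((P.pt _ z).toHom.comp (quasiCoherentMap (algUntensor B B').toLinearMap)).comp
          (quasiCoherentDistrib B B')).app S m)) (a ⊗ₜ[T] b) =
      DualElt.app (D.mul T ((dualMap Q.proj).app T a) ((dualMap Q'.proj).app T b)) T (𝟙 T)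
        (M.map f m)
    rw [← ModFun.Hom.naturality]
    generalize M.map f m = n
    obtain ⟨α, hα, hα'⟩ := dualMap_proj_eq P hP hA Q y hy a
    obtain ⟨β, hβ, hβ'⟩ := dualMap_proj_eq P hP hA Q' y' hy' b
    rw [← hα, ← hβ, ← hD.map_mul]
    refine (pairing_quasiCoherentDistrib (B := B) (B' := B') a b _).trans ?_
    change _ = (conv α β).app T (𝟙 T) (P.evalHom.app T n)
    rw [conv_app, hα', FunElt.convolve_app, dual_map_app, hβ', FunElt.translate_app]
    -- Reassociating `T ⊗ (B ⊗ B')` matches the value at `z` with the nested evaluation of the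
    -- convolution at the two universal points.
    have hF := FunElt.naturality (P.evalHom.app T n) (algInl T (algTensor B B'))
      (algAssoc T B B') ((underlying G).map (algInr T (algTensor B B')) z)
    have hz : (underlying G).map (algAssoc T B B')
        ((underlying G).map (algInr T (algTensor B B')) z) =
        pmul G _ ((underlying G).map (algInl (algTensor T B) B')
          ((underlying G).map (algInr T B) y)) ((underlying G).map (algInr _ B') y') := by
      rw [← points_map_comp, algAssoc, algInr_desc, map_pmul, ← points_map_comp,
        ← points_map_comp, ← points_map_comp, algInl_desc, algInr_desc]
    have hl : algInl T (algTensor B B') ≫ algAssoc T B B' = algInl T B ≫ algInl _ B' :=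
      algInl_desc _ _
    have hn : FunElt.app (P.evalHom.app T n) _ (algInl T (algTensor B B'))
        ((underlying G).map (algInr T (algTensor B B')) z) =
        (algUntensor T (algTensor B B')).symm ((P.pt _ z).toHom.app T n) := by
      rw [P.evalHom_app_app, P.pt_map, dual_map_app, Category.comp_id, DualElt.toHom_app,
        AlgEquiv.symm_apply_apply]
    rw [hz, hl, hn] at hF
    rw [Category.id_comp]
    exact congrArg (fun w => DualElt.app a T (𝟙 T) (algUntensor T B (DualElt.app b (algTensor T B)
      (algInl T B) (algUntensor (algTensor T B) B' w)))) hF.symm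

/-- The counit is evaluation at the unit of the dual, which here is a point of the spectrum. -/
lemma counitHom_isAlgHom (P : SpecModel A (underlying G)) (D : AlgStr (dual M))
    (hD : ∀ S, P.pt S (pone G S) = D.one S) : IsAlgHom A (scalarsAlg K) (counitHom D) := by
  have h (S) (m : M.obj S) : (counitHom D).app S m = DualElt.app (D.one S) S (𝟙 S) m := by
    change DualElt.app ((1 : S) • D.one S) S (𝟙 S) (M.map (𝟙 S) m) = _
    rw [one_smul, M.map_id]
  refine ⟨fun S a b => ?_, fun S => ?_⟩
  · rw [h, h, h, ← hD, (P.pt_mem S _ S (𝟙 S)).1]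
    rfl
  · rw [h, ← hD, (P.pt_mem S _ S (𝟙 S)).2]
    rfl

/-- An isomorphism of algebras `M → 𝔸_X` identifies an affine functor `X` with the spectrum
of `M`. -/
def IsAffineFunctor.specModel {X : CommAlgCat.{u} K ⥤ Type u} (hX : IsAffineFunctor X)
    (i : Hom M (functions X)) (hi : i.Bijective) (hiA : IsAlgHom A (functionsAlg X) i) :
    SpecModel A X where
  pt S x := (dualMap i).app S (evalPoint X S x)
  pt_map f x := by rw [← map_evalPoint, ← (dualMap i).naturality]
  pt_injective S x y h := (hX.bijective S).1 (Subtype.ext ((dualMap_bijective i hi S).1 h))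
  pt_mem S x T f := by
    refine ⟨fun a b => ?_, ?_⟩
    · rw [dualMap_app_app, hiA.map_mul, (evalPoint_mem X S x T f).1]
      rfl
    · rw [dualMap_app_app, hiA.map_one, (evalPoint_mem X S x T f).2]
  exists_pt S a ha := by
    obtain ⟨b, rfl⟩ := (dualMap_bijective i hi S).2 a
    have hb : b ∈ SpecElt (functionsAlg X) S := by
      intro T f
      refine ⟨fun F F' => ?_, ?_⟩
      · obtain ⟨m, rfl⟩ := (hi T).2 F
        obtain ⟨m', rfl⟩ := (hi T).2 F'
        rw [← hiA.map_mul]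
        exact (ha T f).1 m m'
      · rw [← hiA.map_one]
        exact (ha T f).2
    obtain ⟨x, hx⟩ := (hX.bijective S).2 ⟨b, hb⟩
    exact ⟨x, congrArg (fun c => (dualMap i).app S (Subtype.val c)) hx⟩

/-- Evaluating `m` at the point attached to `x` is evaluating the function `i(m)` at `x`; hence
bijectivity of `i` gives that of `evalHom`. -/
lemma IsAffineFunctor.specModel_evalHom {X : CommAlgCat.{u} K ⥤ Type u} (hX : IsAffineFunctor X)
    (i : Hom M (functions X)) (hi : i.Bijective) (hiA : IsAlgHom A (functionsAlg X) i) :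
    (hX.specModel i hi hiA).evalHom = i := by
  apply ModFun.Hom.ext
  funext S
  refine LinearMap.ext fun m => ?_
  apply FunElt.ext
  funext T f x
  change FunElt.app (i.app T (M.map f m)) T (𝟙 T) (X.map (𝟙 T) x) = _
  rw [i.naturality, points_map_id]
  change FunElt.app (i.app S m) T (f ≫ 𝟙 T) x = _
  rw [Category.comp_id]

lemma IsAlgHom.of_inverse {N : ModFun.{u, w} K} {B : AlgStr N} {f : Hom M N} {hf : f.Bijective}
    (h : IsAlgHom B A (f.inverse hf)) : IsAlgHom A B f :=
  ⟨fun S a b => (f.inverse_bijective hf S).1 (by simp [h.map_mul]),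
    fun S => (f.inverse_bijective hf S).1 (by simp [h.map_one])⟩

/-- The functor of commutative bialgebras of functions on an affine functor of monoids, on a
functor of modules isomorphic to the functor of functions. -/
noncomputable def functionBialgebra {M : ModFun.{u, u} K} (hG : IsAffineFunctor (underlying G))
    (i : Hom M (functions (underlying G))) (hi : i.Bijective) : CommBialgFun K :=
  have hiA := AlgStr.transport_isAlgHom (functionsAlg (underlying G)) i hi
  have hM : M.IsReflexive := hG.reflexive.of_bijective (i.inverse hi) (i.inverse_bijective hi)
  have hA : ((functionsAlg (underlying G)).transport i hi).IsComm := fun S a b => (hi S).1 (by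
    rw [hiA.map_mul, hiA.map_mul]
    apply FunElt.ext
    funext T f x
    exact mul_comm _ _)
  let P := hG.specModel i hi hiA
  have hP : P.evalHom = i := hG.specModel_evalHom i hi hiA
  have hP' : P.evalHom.Bijective := by rwa [hP]
  -- The dual of `i` goes from `𝔸_G*` to `M*`, so convolution is pulled back to `M*` along its
  -- inverse.
  let D := (convAlg G).transport _ (Hom.inverse_bijective _ (dualMap_bijective i hi))
  have hD : IsAlgHom (convAlg G) D (dualMap i) :=
    IsAlgHom.of_inverse (AlgStr.transport_isAlgHom _ _ _)
  { toModFun := M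
    alg := (functionsAlg (underlying G)).transport i hi
    comm := hA
    reflexive := hM
    proQuasicoherent := P.isProQuasicoherent hM hA hP'
    dualAlg := D
    comul_isAlgHom := comulHom_isAlgHomToTilde P hP' hA D (by rwa [hP])
    counit_isAlgHom := counitHom_isAlgHom P D fun S => hD.map_one S }

lemma functionBialgebra_isAlgHom {M : ModFun.{u, u} K} (hG : IsAffineFunctor (underlying G))
    (i : Hom M (functions (underlying G))) (hi : i.Bijective) :
    IsAlgHom (functionBialgebra hG i hi).alg (functionsAlg (underlying G)) i :=
  AlgStr.transport_isAlgHom _ _ _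

lemma functionBialgebra_dual_isAlgHom {M : ModFun.{u, u} K} (hG : IsAffineFunctor (underlying G))
    (i : Hom M (functions (underlying G))) (hi : i.Bijective) :
    IsAlgHom (convAlg G) (functionBialgebra hG i hi).dualAlg (dualMap i) :=
  IsAlgHom.of_inverse (hf := dualMap_bijective i hi) (AlgStr.transport_isAlgHom _ _ _)

lemma functionBialgebra_isFunctionBialgebra {M : ModFun.{u, u} K}
    (hG : IsAffineFunctor (underlying G)) (i : Hom M (functions (underlying G)))
    (hi : i.Bijective) : IsFunctionBialgebra G (functionBialgebra hG i hi) i where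
  isAlgHom := functionBialgebra_isAlgHom hG i hi
  bijective := hi
  evalPoint_mul S g h := by
    rw [← (functionBialgebra_dual_isAlgHom hG i hi).map_mul, ← evalPoint_pmul]
    rfl
  evalPoint_one S := (functionBialgebra_dual_isAlgHom hG i hi).map_one S

end FunctionBialgebra

/-! ### Characters, tensor products and factorization through quotients. -/

section SpecMonoid

universe v₁ v₂

variable {R : Type u} [CommRing R] {M : ModFun.{u, v₁} R} {N : ModFun.{u, v₂} R}
  {S T U : CommAlgCat.{u} R}

lemma ModFun.DualElt.map_app_map (f : S ⟶ T) (a : DualElt M S) (m : M.obj S) :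
    DualElt.app ((dual M).map f a) T (𝟙 T) (M.map f m) = f.hom (a.app S (𝟙 S) m) := by
  rw [dual_map_app, ← a.naturality, Category.comp_id, Category.id_comp]

lemma ModFun.DualElt.app_eq_map_app (f : S ⟶ T) (a : DualElt M S) (m : M.obj T) :
    a.app T f m = DualElt.app ((dual M).map f a) T (𝟙 T) m := by
  rw [dual_map_app, Category.comp_id]

/-- Multiplicativity may be tested at the identity of each base change; this suits products in the
dual, which commute with base change. -/
lemma specElt_of_map {A : AlgStr M} {a : DualElt M S}
    (h : ∀ (T : CommAlgCat.{u} R) (f : S ⟶ T),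
      (∀ x y : M.obj T, DualElt.app ((dual M).map f a) T (𝟙 T) (A.mul T x y) =
        DualElt.app ((dual M).map f a) T (𝟙 T) x * DualElt.app ((dual M).map f a) T (𝟙 T) y) ∧
      DualElt.app ((dual M).map f a) T (𝟙 T) (A.one T) = 1) : a ∈ SpecElt A S := by
  intro T f
  simp only [a.app_eq_map_app f]
  exact h T f

lemma pairing_mul {A : AlgStr M} {B : AlgStr N} {a : DualElt M S} {b : DualElt N S}
    (ha : a ∈ SpecElt A S) (hb : b ∈ SpecElt B S) (x y : (ModFun.tensor M N).obj S) :
    pairing M N S ((A.tensor B).mul S x y)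
        ((a : (dual M).obj S) ⊗ₜ[S] (b : (dual N).obj S)) =
      pairing M N S x ((a : (dual M).obj S) ⊗ₜ[S] (b : (dual N).obj S)) *
        pairing M N S y ((a : (dual M).obj S) ⊗ₜ[S] (b : (dual N).obj S)) := by
  change M.obj S ⊗[S] N.obj S at x y
  induction x with
  | zero => simp only [map_zero, LinearMap.zero_apply, zero_mul]
  | add x x' hx hx' => simp only [map_add, LinearMap.add_apply, hx, hx', add_mul]
  | tmul m n =>
    induction y with
    | zero => simp only [map_zero, LinearMap.zero_apply, mul_zero]
    | add y y' hy hy' => simp only [map_add, LinearMap.add_apply, hy, hy', mul_add]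
    | tmul m' n' =>
      change a.app S (𝟙 S) (A.mul S m m') * b.app S (𝟙 S) (B.mul S n n') =
        (a.app S (𝟙 S) m * b.app S (𝟙 S) n) * (a.app S (𝟙 S) m' * b.app S (𝟙 S) n')
      rw [(ha S (𝟙 S)).1, (hb S (𝟙 S)).1, mul_mul_mul_comm]

/-- The factorization of a point through `pointQuotient`, in dual form: `a'` is the tautological
point of the quotient, base changed along its inclusion in `T`. -/
lemma exists_dualMap_proj_eq {K : Type u} [Field K] {M : ModFun.{u, v} K} {A : AlgStr M}
    (hM : M.IsReflexive) (hA : A.IsComm) {T : CommAlgCat.{u} K} (a : DualElt M T)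
    (ha : a ∈ SpecElt A T) :
    ∃ (Q : QCQuotient A) (a' : DualElt (quasiCoherent K Q.alg) T),
      a' ∈ SpecElt (quasiCoherentAlg K Q.alg) T ∧ (dualMap Q.proj).app T a' = a := by
  let Q := pointQuotient hM a ha
  refine ⟨Q, (dual (quasiCoherent K Q.alg)).map (pointQuotientVal hM hA a ha)
    (Hom.toDualElt (T := Q.commAlg hA) (Hom.id _)), map_mem_specElt (toDualElt_mem
      (T := Q.commAlg hA) ⟨fun _ _ _ => rfl, fun _ => rfl⟩) _, ?_⟩
  exact map_pointQuotientVal_point hM hA a ha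

end SpecMonoid

/-! ### The spectrum of a bialgebra as an affine functor of monoids. -/

namespace CommBialgFun

variable {K : Type u} [Field K] (B : CommBialgFun K) {S T : CommAlgCat.{u} K}

/-- The two points factor through quotients as `a'` and `b'`, and their product is `a' ⊗ b'`
composed with the comultiplication into the tensor product of the quotients. Both are
multiplicative, the second by the bialgebra axiom. -/
lemma mul_mem_specElt {a b : DualElt B.toModFun S} (ha : a ∈ SpecElt B.alg S)
    (hb : b ∈ SpecElt B.alg S) : B.dualAlg.mul S a b ∈ SpecElt B.alg S := by
  apply specElt_of_map
  intro T f
  rw [B.dualAlg.map_mul]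
  obtain ⟨Q, a', ha', haa⟩ := exists_dualMap_proj_eq B.reflexive B.comm _ (map_mem_specElt ha f)
  obtain ⟨Q', b', hb', hbb⟩ := exists_dualMap_proj_eq B.reflexive B.comm _ (map_mem_specElt hb f)
  rw [← haa, ← hbb]
  obtain ⟨g, hg, hgeq⟩ := B.comul_isAlgHom Q Q'
  have key (n : B.toModFun.obj T) : DualElt.app (B.dualAlg.mul T ((dualMap Q.proj).app T a')
      ((dualMap Q'.proj).app T b')) T (𝟙 T) n =
      pairing (quasiCoherent K Q.alg) (quasiCoherent K Q'.alg) T (g.app T n)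
        ((a' : (dual (quasiCoherent K Q.alg)).obj T) ⊗ₜ[T]
          (b' : (dual (quasiCoherent K Q'.alg)).obj T)) := by
    have h := congrArg (fun φ => DualElt.app (ModFun.Hom.app φ T n) T (𝟙 T)
      ((a' : (dual (quasiCoherent K Q.alg)).obj T) ⊗ₜ[T]
        (b' : (dual (quasiCoherent K Q'.alg)).obj T))) hgeq
    change pairing (quasiCoherent K Q.alg) (quasiCoherent K Q'.alg) T
        ((ModFun.tensor (quasiCoherent K Q.alg) (quasiCoherent K Q'.alg)).map (𝟙 T) (g.app T n))
        (a' ⊗ₜ[T] b') =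
      DualElt.app (B.dualAlg.mul T ((dualMap Q.proj).app T a') ((dualMap Q'.proj).app T b'))
        T (𝟙 T) (B.toModFun.map (𝟙 T) n) at h
    rw [B.toModFun.map_id, (ModFun.tensor _ _).map_id] at h
    exact h.symm
  refine ⟨fun x y => ?_, ?_⟩
  · rw [key, key, key, hg.map_mul, pairing_mul ha' hb']
  · rw [key, hg.map_one]
    change a'.app T (𝟙 T) ((quasiCoherentAlg K Q.alg).one T) *
      b'.app T (𝟙 T) ((quasiCoherentAlg K Q'.alg).one T) = 1
    rw [(ha' T (𝟙 T)).2, (hb' T (𝟙 T)).2, mul_one]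

/-- The unit of `B*` acts on `B` as the counit, a morphism of algebras by assumption. -/
lemma one_mem_specElt : B.dualAlg.one S ∈ SpecElt B.alg S := by
  apply specElt_of_map
  intro T f
  rw [B.dualAlg.map_one]
  have h (m : B.toModFun.obj T) : DualElt.app (B.dualAlg.one T) T (𝟙 T) m =
      (counitHom B.dualAlg).app T m := by
    change _ = DualElt.app ((1 : T) • B.dualAlg.one T) T (𝟙 T) (B.toModFun.map (𝟙 T) m)
    rw [one_smul, B.toModFun.map_id]
  refine ⟨fun x y => ?_, ?_⟩
  · rw [h, h, h, B.counit_isAlgHom.map_mul]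
    rfl
  · rw [h, B.counit_isAlgHom.map_one]
    rfl

/-- The monoid structure on the points of the spectrum of a functor of commutative bialgebras. -/
instance specMonoid (S : CommAlgCat.{u} K) : Monoid (SpecElt B.alg S) where
  mul a b := ⟨B.dualAlg.mul S a b, B.mul_mem_specElt a.2 b.2⟩
  one := ⟨B.dualAlg.one S, B.one_mem_specElt⟩
  mul_assoc a b c := Subtype.ext (B.dualAlg.mul_assoc S a b c)
  one_mul a := Subtype.ext (B.dualAlg.one_mul S a)
  mul_one a := Subtype.ext (B.dualAlg.mul_one S a)

instance small_specElt (S : CommAlgCat.{u} K) : Small.{u} (SpecElt B.alg S) :=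
  have : Small.{u} ((dual B.toModFun).obj S) := B.reflexive.small_dualElt S
  small_of_injective (f := fun a : SpecElt B.alg S => (a : (dual B.toModFun).obj S))
    Subtype.val_injective

/-- Functoriality of the points of the spectrum. -/
def specMap (f : S ⟶ T) : SpecElt B.alg S →* SpecElt B.alg T where
  toFun a := ⟨(dual B.toModFun).map f a, map_mem_specElt a.2 f⟩
  map_one' := Subtype.ext (B.dualAlg.map_one f)
  map_mul' a b := Subtype.ext (B.dualAlg.map_mul f a b)

/-- Functoriality of the small model of the points of the spectrum. -/
noncomputable def specShrinkMap (f : S ⟶ T) :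
    Shrink.{u} (SpecElt B.alg S) →* Shrink.{u} (SpecElt B.alg T) :=
  (Shrink.mulEquiv.symm.toMonoidHom.comp (B.specMap f)).comp Shrink.mulEquiv.toMonoidHom

lemma specShrinkMap_val (f : S ⟶ T) (x : Shrink.{u} (SpecElt B.alg S)) :
    (Shrink.mulEquiv (B.specShrinkMap f x)).1 =
      (dual B.toModFun).map f (Shrink.mulEquiv x).1 :=
  congrArg Subtype.val (Shrink.mulEquiv.apply_symm_apply (B.specMap f (Shrink.mulEquiv x)))

lemma shrink_ext {x y : Shrink.{u} (SpecElt B.alg S)}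
    (h : (Shrink.mulEquiv x).1 = (Shrink.mulEquiv y).1) : x = y :=
  Shrink.mulEquiv.injective (Subtype.ext h)

/-- The functor of monoids `Spec B`. -/
noncomputable def spec : CommAlgCat.{u} K ⥤ MonCat.{u} where
  obj S := MonCat.of (Shrink.{u} (SpecElt B.alg S))
  map f := MonCat.ofHom (B.specShrinkMap f)
  map_id S := MonCat.ext fun x => B.shrink_ext
    ((B.specShrinkMap_val (𝟙 S) x).trans ((dual B.toModFun).map_id S _))
  map_comp f g := MonCat.ext fun x => B.shrink_ext <| by
    refine (B.specShrinkMap_val (f ≫ g) x).trans (((dual B.toModFun).map_comp f g _).trans ?_)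
    rw [← specShrinkMap_val, ← specShrinkMap_val]
    rfl

/-- The points of `Spec B`. -/
noncomputable def specModel : SpecModel B.alg (underlying B.spec) where
  pt S x := (Shrink.mulEquiv (show Shrink.{u} (SpecElt B.alg S) from x)).1
  pt_map f x := B.specShrinkMap_val f x
  pt_injective _ _ _ h := B.shrink_ext h
  pt_mem S x := (Shrink.mulEquiv (show Shrink.{u} (SpecElt B.alg S) from x)).2
  exists_pt S a ha := ⟨(Shrink.mulEquiv.symm (⟨a, ha⟩ : SpecElt B.alg S)),
    congrArg Subtype.val (Shrink.mulEquiv.apply_symm_apply (⟨a, ha⟩ : SpecElt B.alg S))⟩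

lemma specModel_pt_pmul (g h : (underlying B.spec).obj S) :
    B.specModel.pt S (pmul B.spec S g h) =
      B.dualAlg.mul S (B.specModel.pt S g) (B.specModel.pt S h) :=
  congrArg Subtype.val (map_mul Shrink.mulEquiv
    (show Shrink.{u} (SpecElt B.alg S) from g) (show Shrink.{u} (SpecElt B.alg S) from h))

lemma specModel_pt_pone : B.specModel.pt S (pone B.spec S) = B.dualAlg.one S :=
  congrArg Subtype.val (map_one (Shrink.mulEquiv (α := SpecElt B.alg S)))

lemma specModel_evalHom_bijective : B.specModel.evalHom.Bijective :=
  B.specModel.evalHom_bijective B.reflexive B.comm B.proQuasicoherent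

lemma dualMap_evalHom_evalPoint {M : ModFun.{u, v} K} {A : AlgStr M}
    {X : CommAlgCat.{u} K ⥤ Type w} (P : SpecModel A X) (x : X.obj S) :
    (dualMap P.evalHom).app S (evalPoint X S x) = P.pt S x := by
  apply DualElt.ext
  funext T f
  refine LinearMap.ext fun m => ?_
  change (P.pt T (X.map f x)).app T (𝟙 T) (M.map (𝟙 T) m) = _
  rw [P.pt_map, dual_map_app, M.map_id, Category.comp_id]

/-- The isomorphism of algebras from `B` onto the functions on `Spec B` transports smallness and
reflexivity, and turns characters of functions into characters of `B`, which are the points. -/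
lemma isAffineFunctor_spec : IsAffineFunctor (underlying B.spec) where
  small S := small_of_surjective (B.specModel_evalHom_bijective S).2
  reflexive := B.reflexive.of_bijective _ B.specModel_evalHom_bijective
  bijective S := by
    refine ⟨fun x y h => B.specModel.pt_injective S ?_, fun c => ?_⟩
    · rw [← dualMap_evalHom_evalPoint, ← dualMap_evalHom_evalPoint]
      exact congrArg (fun d => (dualMap B.specModel.evalHom).app S (Subtype.val d)) h
    · have hc : (dualMap B.specModel.evalHom).app S c.1 ∈ SpecElt B.alg S := by
        intro T f
        refine ⟨fun m n => ?_, ?_⟩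
        · rw [dualMap_app_app, B.specModel.evalHom_isAlgHom.map_mul, (c.2 T f).1]
          rfl
        · rw [dualMap_app_app, B.specModel.evalHom_isAlgHom.map_one, (c.2 T f).2]
      obtain ⟨x, hx⟩ := B.specModel.exists_pt S _ hc
      rw [← dualMap_evalHom_evalPoint] at hx
      exact ⟨x, Subtype.ext ((dualMap_bijective _ B.specModel_evalHom_bijective S).1 hx)⟩

end CommBialgFun

/-! ### One-sided products on the dual of a reflexive functor. -/

section ReflexiveProducts

variable {R : Type u} [CommRing R] {M : ModFun.{u, v} R} {T : CommAlgCat.{u} R}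

/-- For fixed `c` and `m`, the form `a ↦ (ac)(m)` on `M*` is an element of `M**(T)`, hence
evaluation at an element of `M(T)`. This replaces a formula for the comultiplication as a sum of
tensors. -/
lemma ModFun.IsReflexive.exists_mul_right (hM : M.IsReflexive) (D : AlgStr (dual M))
    (c : DualElt M T) (m : M.obj T) : ∃ n : M.obj T, ∀ (U) (k : T ⟶ U) (a : DualElt M U),
      a.app U (𝟙 U) (M.map k n) =
        DualElt.app (D.mul U a ((dual M).map k c)) U (𝟙 U) (M.map k m) := by
  obtain ⟨n, hn⟩ := (hM T).2 (⟨fun U k =>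
    { toFun := fun a : DualElt M U =>
        DualElt.app (D.mul U a ((dual M).map k c)) U (𝟙 U) (M.map k m)
      map_add' := fun a b => by rw [map_add]; rfl
      map_smul' := fun s a => by rw [map_smul]; rfl }, fun {U V} k l a => by
        change DualElt.app (D.mul V ((dual M).map l a) ((dual M).map (k ≫ l) c)) V (𝟙 V)
          (M.map (k ≫ l) m) = _
        rw [(dual M).map_comp, ← D.map_mul, M.map_comp, DualElt.map_app_map]
        rfl⟩ : DualElt (dual M) T)
  exact ⟨n, fun U k a => congrArg (fun z : DualElt (dual M) T => z.app U k a) hn⟩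

lemma ModFun.IsReflexive.exists_mul_left (hM : M.IsReflexive) (D : AlgStr (dual M))
    (c : DualElt M T) (m : M.obj T) : ∃ n : M.obj T, ∀ (U) (k : T ⟶ U) (a : DualElt M U),
      a.app U (𝟙 U) (M.map k n) =
        DualElt.app (D.mul U ((dual M).map k c) a) U (𝟙 U) (M.map k m) := by
  obtain ⟨n, hn⟩ := (hM T).2 (⟨fun U k =>
    { toFun := fun a : DualElt M U =>
        DualElt.app (D.mul U ((dual M).map k c) a) U (𝟙 U) (M.map k m)
      map_add' := fun a b => by rw [map_add]; rfl
      map_smul' := fun s a => by rw [map_smul]; rfl }, fun {U V} k l a => by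
        change DualElt.app (D.mul V ((dual M).map (k ≫ l) c) ((dual M).map l a)) V (𝟙 V)
          (M.map (k ≫ l) m) = _
        rw [(dual M).map_comp, ← D.map_mul, M.map_comp, DualElt.map_app_map]
        rfl⟩ : DualElt (dual M) T)
  exact ⟨n, fun U k a => congrArg (fun z : DualElt (dual M) T => z.app U k a) hn⟩

end ReflexiveProducts

/-! ### The product of the dual of a bialgebra is convolution on its spectrum. -/

namespace CommBialgFun

variable {K : Type u} [Field K] (B : CommBialgFun K) {S T : CommAlgCat.{u} K}

/-- The convolution product of a dual element with a function on `Spec B` is computed by the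
product of `B*`. -/
lemma exists_convolve_evalHom (b : DualElt (functions (underlying B.spec)) T)
    (m : B.toModFun.obj T) : ∃ n : B.toModFun.obj T,
      FunElt.convolve b (B.specModel.evalHom.app T m) = B.specModel.evalHom.app T n ∧
      ∀ a : DualElt B.toModFun T, a.app T (𝟙 T) n = DualElt.app (B.dualAlg.mul T a
        ((dualMap B.specModel.evalHom).app T b)) T (𝟙 T) m := by
  obtain ⟨n, hn⟩ := B.reflexive.exists_mul_right B.dualAlg
    ((dualMap B.specModel.evalHom).app T b) m
  refine ⟨n, ?_, fun a => ?_⟩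
  · apply FunElt.ext
    funext U k g
    -- The translate `h ↦ m(gh)` is the function given by `p`, since the product of points is that
    -- of `B*`. So `b` can be evaluated on it through the dual of `evalHom`.
    obtain ⟨p, hp⟩ := B.reflexive.exists_mul_left B.dualAlg (B.specModel.pt U g)
      (B.toModFun.map k m)
    have ht : FunElt.translate (B.specModel.evalHom.app T m) k g =
        B.specModel.evalHom.app U p := by
      apply FunElt.ext
      funext V l h
      rw [FunElt.translate_app, SpecModel.evalHom_app_app, SpecModel.evalHom_app_app,
        specModel_pt_pmul, hp, SpecModel.pt_map, B.toModFun.map_comp]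
    rw [FunElt.convolve_app, ht, SpecModel.evalHom_app_app, hn]
    have h := hp U (𝟙 U) ((dual B.toModFun).map k ((dualMap B.specModel.evalHom).app T b))
    rw [(dual B.toModFun).map_id, B.toModFun.map_id, B.toModFun.map_id, dual_map_app,
      Category.comp_id, dualMap_app_app] at h
    exact h
  · have h := hn T (𝟙 T) a
    rwa [B.toModFun.map_id, B.toModFun.map_id, (dual B.toModFun).map_id] at h

lemma dualMap_evalHom_isAlgHom :
    IsAlgHom (convAlg B.spec) B.dualAlg (dualMap B.specModel.evalHom) := by
  refine ⟨fun S a b => ?_, fun S => ?_⟩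
  · apply DualElt.ext
    funext T f
    refine LinearMap.ext fun m => ?_
    obtain ⟨n, hn, hn'⟩ := B.exists_convolve_evalHom
      ((dual (functions (underlying B.spec))).map f b) m
    rw [DualElt.app_eq_map_app, DualElt.app_eq_map_app f (B.dualAlg.mul S _ _),
      ← (dualMap B.specModel.evalHom).naturality, B.dualAlg.map_mul, (convAlg B.spec).map_mul,
      ← (dualMap B.specModel.evalHom).naturality, ← (dualMap B.specModel.evalHom).naturality,
      ← hn']
    change (conv ((dual (functions (underlying B.spec))).map f a)
      ((dual (functions (underlying B.spec))).map f b)).app T (𝟙 T)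
        (B.specModel.evalHom.app T m) = _
    rw [conv_app, (dual (functions (underlying B.spec))).map_id, hn]
    rfl
  · exact (dualMap_evalHom_evalPoint _ _).trans B.specModel_pt_pone

end CommBialgFun

/-! ### Bijective morphisms of bialgebras are isomorphisms. -/

section DualInverse

universe v₁ v₂

variable {R : Type u} [CommRing R] {M : ModFun.{u, v₁} R} {N : ModFun.{u, v₂} R}

lemma IsAlgHom.dualMap_inverse {f : Hom M N} (hf : f.Bijective) {D : AlgStr (dual M)}
    {E : AlgStr (dual N)} (h : IsAlgHom E D (dualMap f)) :
    IsAlgHom D E (dualMap (f.inverse hf)) := by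
  have hinv (S) (a : DualElt M S) :
      (dualMap f).app S ((dualMap (f.inverse hf)).app S a) = a := by
    apply DualElt.ext
    funext T g
    refine LinearMap.ext fun m => ?_
    exact congrArg (a.app T g) (f.inverse_app hf T m)
  refine ⟨fun S a b => (dualMap_bijective f hf S).1 ?_, fun S => (dualMap_bijective f hf S).1 ?_⟩
  · rw [h.map_mul, hinv, hinv, hinv]
  · rw [h.map_one, hinv]

/-- A morphism of functors of bialgebras that is bijective on all values is an isomorphism. -/
noncomputable def CommBialgFun.isoOfBijective {B C : CommBialgFun R} (f : B ⟶ C)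
    (hf : f.hom.Bijective) : B ≅ C where
  hom := f
  inv := ⟨f.hom.inverse hf, f.isAlgHom.inverse hf, f.dual_isAlgHom.dualMap_inverse hf⟩
  hom_inv_id := by
    apply CommBialgFun.Hom.ext
    apply ModFun.Hom.ext
    funext S
    exact LinearMap.ext fun m => f.hom.inverse_app hf S m
  inv_hom_id := by
    apply CommBialgFun.Hom.ext
    apply ModFun.Hom.ext
    funext S
    exact LinearMap.ext fun m => f.hom.app_inverse hf S m

end DualInverse

/-! ### Functoriality of functions and of convolution. -/

section FunctionsMap

variable {R : Type u} [CommRing R]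

lemma functionsMap_isAlgHom {X Y : CommAlgCat.{u} R ⥤ Type v} (h : X ⟶ Y) :
    IsAlgHom (functionsAlg Y) (functionsAlg X) (functionsMap h) :=
  ⟨fun _ _ _ => rfl, fun _ => rfl⟩

lemma dualMap_functionsMap_evalPoint {X Y : CommAlgCat.{u} R ⥤ Type v} (h : X ⟶ Y)
    (S : CommAlgCat.{u} R) (x : X.obj S) :
    (dualMap (functionsMap h)).app S (evalPoint X S x) = evalPoint Y S (h.app S x) := by
  apply DualElt.ext
  funext T f
  refine LinearMap.ext fun F => ?_
  change FunElt.app F T (𝟙 T) (h.app T (X.map f x)) = FunElt.app F T (𝟙 T) (Y.map f (h.app S x))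
  rw [NatTrans.naturality_apply]

variable {G G' : CommAlgCat.{u} R ⥤ MonCat.{u}} (h : G ⟶ G')

/-- The morphism of functors of sets underlying a morphism of functors of monoids. -/
abbrev underlyingMap : underlying G ⟶ underlying G' := Functor.whiskerRight h (forget MonCat.{u})

lemma underlyingMap_pmul (S : CommAlgCat.{u} R) (x y : (underlying G).obj S) :
    (underlyingMap h).app S (pmul G S x y) =
      pmul G' S ((underlyingMap h).app S x) ((underlyingMap h).app S y) :=
  MonoidHom.map_mul (h.app S).hom (show G.obj S from x) (show G.obj S from y)

lemma underlyingMap_pone (S : CommAlgCat.{u} R) :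
    (underlyingMap h).app S (pone G S) = pone G' S :=
  MonoidHom.map_one (h.app S).hom

/-- Both products evaluate `a(g ↦ b(k ↦ ·))` on the same function, because `h` preserves products of
points. -/
lemma dualMap_functionsMap_isAlgHom :
    IsAlgHom (convAlg G) (convAlg G') (dualMap (functionsMap (underlyingMap h))) := by
  refine ⟨fun S a b => ?_, fun S => ?_⟩
  · apply DualElt.ext
    funext T f
    refine LinearMap.ext fun F => ?_
    change DualElt.app a T f _ = DualElt.app a T f _
    congr 1
    apply FunElt.ext
    funext U k g
    change DualElt.app b U (f ≫ k) _ = DualElt.app b U (f ≫ k) _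
    congr 1
    apply FunElt.ext
    funext V l g'
    change FunElt.app F V (k ≫ l) ((underlyingMap h).app V
        (pmul G V ((underlying G).map l g) g')) =
      FunElt.app F V (k ≫ l) (pmul G' V ((underlying G').map l ((underlyingMap h).app U g))
        ((underlyingMap h).app V g'))
    rw [underlyingMap_pmul, NatTrans.naturality_apply]
  · exact (dualMap_functionsMap_evalPoint _ S _).trans
      (congrArg (evalPoint (underlying G') S) (underlyingMap_pone h S))

end FunctionsMap

/-! ### The anti-equivalence. -/

namespace AffineMonoidFun

variable {K : Type u} [Field K]

instance small_functions (G : AffineMonoidFun K) (S : CommAlgCat.{u} K) :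
    Small.{u} ((functions (underlying G.obj)).obj S) :=
  G.property.small S

/-- The functor of commutative bialgebras `𝔸_G`. -/
noncomputable def bialg (G : AffineMonoidFun K) : CommBialgFun K :=
  functionBialgebra G.property (ofShrink.{u, u + 1, u} (functions (underlying G.obj)))
    (ofShrink_bijective.{u, u + 1, u} _)

/-- The identification of the small model `𝔸_G` with the functor of functions. -/
noncomputable def incl (G : AffineMonoidFun K) :
    Hom G.bialg.toModFun (functions (underlying G.obj)) :=
  ofShrink.{u, u + 1, u} (functions (underlying G.obj))

lemma incl_bijective (G : AffineMonoidFun K) : G.incl.Bijective :=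
  ofShrink_bijective.{u, u + 1, u} (functions (underlying G.obj))

lemma incl_isAlgHom (G : AffineMonoidFun K) :
    IsAlgHom G.bialg.alg (functionsAlg (underlying G.obj)) G.incl :=
  functionBialgebra_isAlgHom _ _ _

lemma dualMap_incl_isAlgHom (G : AffineMonoidFun K) :
    IsAlgHom (convAlg G.obj) G.bialg.dualAlg (dualMap G.incl) :=
  functionBialgebra_dual_isAlgHom _ _ _

variable {G G' : AffineMonoidFun K}

/-- The morphism `𝔸_G' → 𝔸_G` induced by a morphism `G → G'`. -/
noncomputable def bialgMap (h : G ⟶ G') : G'.bialg ⟶ G.bialg where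
  hom := (G'.incl.comp (functionsMap (underlyingMap h.hom))).comp (G.incl.inverse G.incl_bijective)
  isAlgHom := (G'.incl_isAlgHom.comp (functionsMap_isAlgHom _)).comp
    (G.incl_isAlgHom.inverse G.incl_bijective)
  dual_isAlgHom := ((G.dualMap_incl_isAlgHom.dualMap_inverse G.incl_bijective).comp
    (dualMap_functionsMap_isAlgHom h.hom)).comp G'.dualMap_incl_isAlgHom

lemma bialgMap_comp_incl (h : G ⟶ G') :
    (bialgMap h).hom.comp G.incl = G'.incl.comp (functionsMap (underlyingMap h.hom)) := by
  apply ModFun.Hom.ext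
  funext S
  exact LinearMap.ext fun m => G.incl.app_inverse G.incl_bijective S _

lemma bialg_hom_ext {B : CommBialgFun K} {f g : B ⟶ G.bialg}
    (h : f.hom.comp G.incl = g.hom.comp G.incl) : f = g := by
  apply CommBialgFun.Hom.ext
  apply ModFun.Hom.ext
  funext S
  exact LinearMap.ext fun m => (G.incl_bijective S).1
    (congrArg (fun φ => ModFun.Hom.app φ S m) h)

variable (K) in
/-- The contravariant functor `G ↦ 𝔸_G`. -/
noncomputable def bialgFunctor : (AffineMonoidFun K)ᵒᵖ ⥤ CommBialgFun K where
  obj G := G.unop.bialg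
  map h := bialgMap h.unop
  map_id G := bialg_hom_ext (bialgMap_comp_incl _)
  map_comp {G₁ G₂ G₃} f g := bialg_hom_ext <| by
    refine (bialgMap_comp_incl _).trans ?_
    have h₁ := bialgMap_comp_incl f.unop
    have h₂ := bialgMap_comp_incl g.unop
    change _ = (bialgMap f.unop).hom.comp ((bialgMap g.unop).hom.comp G₃.unop.incl)
    rw [h₂]
    exact congrArg (fun φ => φ.comp (functionsMap (underlyingMap g.unop.hom))) h₁.symm

/-- The points of an affine functor of monoids as the points of the spectrum of its bialgebra. -/
noncomputable def specModel (G : AffineMonoidFun K) : SpecModel G.bialg.alg (underlying G.obj) :=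
  G.property.specModel G.incl G.incl_bijective G.incl_isAlgHom

lemma specModel_pt_pmul (S : CommAlgCat.{u} K) (x y : (underlying G.obj).obj S) :
    G.specModel.pt S (pmul G.obj S x y) =
      G.bialg.dualAlg.mul S (G.specModel.pt S x) (G.specModel.pt S y) :=
  (congrArg ((dualMap G.incl).app S) (evalPoint_pmul x y)).trans
    (G.dualMap_incl_isAlgHom.map_mul S _ _)

lemma specModel_pt_pone (S : CommAlgCat.{u} K) :
    G.specModel.pt S (pone G.obj S) = G.bialg.dualAlg.one S :=
  G.dualMap_incl_isAlgHom.map_one S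

lemma specModel_evalHom : G.specModel.evalHom = G.incl :=
  G.property.specModel_evalHom _ _ _

/-- Composition with functions determines the evaluation at the image of each point, and in an
affine functor a point is determined by its evaluation. -/
instance : (bialgFunctor K).Faithful where
  map_injective {G₁ G₂} f g hfg := by
    apply Quiver.Hom.unop_inj
    have h₁ := bialgMap_comp_incl f.unop
    have h₂ := bialgMap_comp_incl g.unop
    have hfg' : bialgMap f.unop = bialgMap g.unop := hfg
    rw [hfg', h₂] at h₁
    apply ObjectProperty.hom_ext
    apply NatTrans.ext
    funext S
    apply MonCat.ext
    intro x
    apply (G₁.unop.property.bijective S).1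
    apply Subtype.ext
    have h : functionsMap (underlyingMap f.unop.hom) =
        functionsMap (underlyingMap g.unop.hom) := by
      apply ModFun.Hom.ext
      funext T
      refine LinearMap.ext fun F => ?_
      obtain ⟨m, rfl⟩ := (G₁.unop.incl_bijective T).2 F
      exact (congrArg (fun φ => ModFun.Hom.app φ T m) h₁).symm
    exact (dualMap_functionsMap_evalPoint (underlyingMap f.unop.hom) S x).symm.trans
      ((congrArg (fun φ => (dualMap φ).app S (evalPoint _ S x)) h).trans
        (dualMap_functionsMap_evalPoint (underlyingMap g.unop.hom) S x))

/-- A character composed with a morphism of algebras is a character, and every character of the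
functions on `G'` is a point because `G'` is affine. -/
lemma exists_pt_eq_dualMap (f : G'.bialg ⟶ G.bialg) (S : CommAlgCat.{u} K)
    (x : (underlying G.obj).obj S) : ∃ y : (underlying G'.obj).obj S,
      G'.specModel.pt S y = (dualMap f.hom).app S (G.specModel.pt S x) := by
  apply G'.specModel.exists_pt
  intro T k
  refine ⟨fun m n => ?_, ?_⟩
  · rw [dualMap_app_app, f.isAlgHom.map_mul, (G.specModel.pt_mem S x T k).1]
    rfl
  · rw [dualMap_app_app, f.isAlgHom.map_one, (G.specModel.pt_mem S x T k).2]

/-- The map on points induced by a morphism of bialgebras. -/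
noncomputable def pointMap (f : G'.bialg ⟶ G.bialg) (S : CommAlgCat.{u} K)
    (x : (underlying G.obj).obj S) : (underlying G'.obj).obj S :=
  (exists_pt_eq_dualMap f S x).choose

lemma pt_pointMap (f : G'.bialg ⟶ G.bialg) (S : CommAlgCat.{u} K)
    (x : (underlying G.obj).obj S) :
    G'.specModel.pt S (pointMap f S x) = (dualMap f.hom).app S (G.specModel.pt S x) :=
  (exists_pt_eq_dualMap f S x).choose_spec

/-- The product of points is that of the dual algebra, which the dual of `f` respects. -/
lemma pointMap_pmul (f : G'.bialg ⟶ G.bialg) (S : CommAlgCat.{u} K)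
    (x y : (underlying G.obj).obj S) : pointMap f S (pmul G.obj S x y) =
      pmul G'.obj S (pointMap f S x) (pointMap f S y) := by
  apply G'.specModel.pt_injective
  rw [pt_pointMap, specModel_pt_pmul, specModel_pt_pmul, pt_pointMap, pt_pointMap,
    f.dual_isAlgHom.map_mul]

lemma pointMap_pone (f : G'.bialg ⟶ G.bialg) (S : CommAlgCat.{u} K) :
    pointMap f S (pone G.obj S) = pone G'.obj S := by
  apply G'.specModel.pt_injective
  rw [pt_pointMap, specModel_pt_pone, specModel_pt_pone, f.dual_isAlgHom.map_one]

lemma pointMap_map (f : G'.bialg ⟶ G.bialg) {S T : CommAlgCat.{u} K} (k : S ⟶ T)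
    (x : (underlying G.obj).obj S) : pointMap f T ((underlying G.obj).map k x) =
      (underlying G'.obj).map k (pointMap f S x) := by
  apply G'.specModel.pt_injective
  rw [pt_pointMap, G'.specModel.pt_map, pt_pointMap, G.specModel.pt_map,
    (dualMap f.hom).naturality]

/-- The morphism of functors of monoids induced by a morphism of bialgebras. -/
noncomputable def ofBialgHom (f : G'.bialg ⟶ G.bialg) : G ⟶ G' :=
  ObjectProperty.homMk
    { app S := MonCat.ofHom
        { toFun := fun x : G.obj.obj S => (show G'.obj.obj S from pointMap f S x)
          map_one' := pointMap_pone f S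
          map_mul' := pointMap_pmul f S }
      naturality _ _ k := MonCat.ext fun x => pointMap_map f k x }

lemma bialgMap_ofBialgHom (f : G'.bialg ⟶ G.bialg) : bialgMap (ofBialgHom f) = f := by
  apply bialg_hom_ext
  rw [bialgMap_comp_incl, ← specModel_evalHom, ← specModel_evalHom]
  apply ModFun.Hom.ext
  funext S
  refine LinearMap.ext fun m => ?_
  apply FunElt.ext
  funext T k x
  change (G'.specModel.pt T (pointMap f T x)).app T (𝟙 T) (G'.bialg.toModFun.map k m) =
    (G.specModel.pt T x).app T (𝟙 T) (G.bialg.toModFun.map k (f.hom.app S m))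
  rw [pt_pointMap, dualMap_app_app, f.hom.naturality]

instance : (bialgFunctor K).Full where
  map_surjective f := ⟨(ofBialgHom f).op, bialgMap_ofBialgHom f⟩

/-- The affine functor of monoids `Spec B`. -/
noncomputable def ofBialg (B : CommBialgFun K) : AffineMonoidFun K :=
  ⟨B.spec, B.isAffineFunctor_spec⟩

/-- A functor of commutative bialgebras is the bialgebra of functions on its spectrum. -/
noncomputable def toBialgOfBialg (B : CommBialgFun K) : B ⟶ (ofBialg B).bialg where
  hom := B.specModel.evalHom.comp ((ofBialg B).incl.inverse (ofBialg B).incl_bijective)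
  isAlgHom := B.specModel.evalHom_isAlgHom.comp
    ((ofBialg B).incl_isAlgHom.inverse (ofBialg B).incl_bijective)
  dual_isAlgHom := ((ofBialg B).dualMap_incl_isAlgHom.dualMap_inverse
    (ofBialg B).incl_bijective).comp B.dualMap_evalHom_isAlgHom

lemma toBialgOfBialg_bijective (B : CommBialgFun K) : (toBialgOfBialg B).hom.Bijective :=
  fun S => ((ofBialg B).incl.inverse_bijective (ofBialg B).incl_bijective S).comp
    (B.specModel_evalHom_bijective S)

/-- `B` is isomorphic, as a bialgebra, to the functions on its spectrum. -/
instance : (bialgFunctor K).EssSurj where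
  mem_essImage B := ⟨Opposite.op (ofBialg B),
    ⟨(CommBialgFun.isoOfBijective _ (toBialgOfBialg_bijective B)).symm⟩⟩

instance : (bialgFunctor K).IsEquivalence where

end AffineMonoidFun

theorem mainTheorem11 (K : Type u) [Field K] :
    ∃ (e : (AffineMonoidFun K)ᵒᵖ ≌ CommBialgFun K)
      (i : ∀ G : AffineMonoidFun K,
        ModFun.Hom (e.functor.obj (Opposite.op G)).toModFun (functions (underlying G.obj))),
      (∀ G : AffineMonoidFun K,
        IsFunctionBialgebra G.obj (e.functor.obj (Opposite.op G)) (i G)) ∧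
      ∀ (G G' : AffineMonoidFun K) (h : G ⟶ G'),
        (e.functor.map h.op).hom.comp (i G) =
          (i G').comp (functionsMap (Functor.whiskerRight h.hom (forget MonCat.{u}))) :=
  ⟨(AffineMonoidFun.bialgFunctor K).asEquivalence, fun G => AffineMonoidFun.incl G,
    fun G => functionBialgebra_isFunctionBialgebra G.property _ (AffineMonoidFun.incl_bijective G),
    fun _ _ h => AffineMonoidFun.bialgMap_comp_incl h⟩
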